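/- Let $X$ be a separable Banach space over $\mathbb K=\mathbb R$ or $\mathbb C$, with closed unit ball $B_X$, and let $\mathbb S\subseteq\mathbb K$ be either $\{-1,1\}$ or $\{\epsilon\in\mathbb K:|\epsilon|=1\}$. For bounded $f:\mathbb S\to\mathbb R$ put $\operatorname{osc}_{\epsilon\in\mathbb S}f(\epsilon)=\sup_{\mathbb S}f-\inf_{\mathbb S}f$. An approximating sequence (a.s.) is a sequence $(T_k)_{k\ge1}$ of bounded finite rank operators on $X$ with $\|T_kx-x\|\to0$ for every $x\in X$; we put $T_0=0$ and $\Delta T_k=T_k-T_{k-1}$. It is unconditional if there is a constant $C$ with $$\Bigl\|\sum_{k=1}^n\epsilon_k\Delta T_k\Bigr\|\le C\quad\text{for all } n \text{ and all } \epsilon_k\in\mathbb S,\qquad(*)$$ and commuting if $T_kT_l=T_lT_k$ for all $k,l$. For a vector space topology $\tau$ on $X$, $(u(\tau))$ means: for all $u\in X$ and all norm bounded sequences $(v_j)$ in $X$ with $v_j\to0$ in $\tau$, $\operatorname{osc}_{\epsilon\in\mathbb S}\|\epsilon u+v_j\|\to0$. For a commuting a.s. $(T_k)$, $(u(T_k))$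 means: for all $\varepsilon>0$ and $n\ge1$ there is $m\ge n$ such that $\operatorname{osc}_{\epsilon\in\mathbb S}\|\epsilon x+y\|\le\varepsilon$ for all $x\in T_nB_X$ and $y\in(\mathrm{Id}-T_m)B_X$. $X$ admits unconditional skipped blocking decompositions if for each $\varepsilon>0$ there is an unconditional a.s. $(S_k)$ such that $\bigl\|\sum_k\epsilon_kx_k\bigr\|\le(1+\varepsilon)\bigl\|\sum_kx_k\bigr\|$ for all $0\le a_1<b_1<a_2<b_2<\dots$, all finite sums with $x_k\in(S_{b_k}-S_{a_k})X$, and all $\epsilon_k\in\mathbb S$ (where $S_0=0$). $X$ has the metric unconditional approximation property (umap) if for every $\varepsilon>0$ there is an a.s. $(T_k)$ satisfying $(*)$ with $C=1+\varepsilon$. $X$ has finite cotype if there are $2\le q<\infty$ and a constant $C$ such that $\bigl(\sum_{i=1}^n\|x_i\|^q\bigr)^{1/q}\le C\cdot\operatorname{average}_{\pm}\bigl\|\sum_{i=1}^n\pm x_i\bigr\|$ for all finite families $x_1,\dots,x_n\in X$. **Theorem.** Consider the following properties. (i) There are an unconditional commuting a.s. $(T_k)$ and a vector space topology $\tau$ on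 $X$ such that $X$ has $(u(\tau))$ and $T_kx\to x$ in $\tau$ uniformly for $x\in B_X$. (ii) $X$ has $(u(T_k))$ for some unconditional commuting a.s. $(T_k)$. (iii) $X$ admits unconditional skipped blocking decompositions. (iv) $X$ has umap. Then (iv)$\Rightarrow$(i)$\Leftrightarrow$(ii)$\Rightarrow$(iii). If $X$ has finite cotype, then (iii)$\Rightarrow$(iv). -/

import Mathlib

open Filter Topology

/-- The oscillation `sup f - inf f` of a real function over the set of signs `S`. It is only used
for functions that are bounded on the nonempty set `S`. -/
noncomputable def signOsc {𝕜 : Type*} (S : Set 𝕜) (f : 𝕜 → ℝ) : ℝ :=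
  sSup (f '' S) - sInf (f '' S)

section Defs

variable {𝕜 : Type*} [RCLike 𝕜] {X : Type*} [NormedAddCommGroup X] [NormedSpace 𝕜 X]

/-- An approximating sequence `T 1, T 2, …` of bounded finite rank operators converging strongly
to the identity. The index `0` only carries the convention `T 0 = 0`. -/
structure IsApproxSeq (T : ℕ → X →L[𝕜] X) : Prop where
  zero : T 0 = 0
  finite_rank : ∀ k, FiniteDimensional 𝕜 (LinearMap.range (T k : X →ₗ[𝕜] X))
  tendsto : ∀ x, Tendsto (fun k => T k x) atTop (𝓝 x)

/-- All signed partial sums of the difference sequence, with signs in `S`, have norm at most `C`. -/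
def UncondBound (S : Set 𝕜) (T : ℕ → X →L[𝕜] X) (C : ℝ) : Prop :=
  ∀ (n : ℕ) (θ : ℕ → 𝕜), (∀ k, θ k ∈ S) →
    ‖∑ k ∈ Finset.range n, θ k • (T (k + 1) - T k)‖ ≤ C

/-- An unconditional approximating sequence (for the signs `S`). -/
def IsUncondApproxSeq (S : Set 𝕜) (T : ℕ → X →L[𝕜] X) : Prop :=
  IsApproxSeq T ∧ ∃ C : ℝ, UncondBound S T C

/-- The operators of the sequence commute with each other. -/
def IsCommutingSeq (T : ℕ → X →L[𝕜] X) : Prop :=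
  ∀ k l, (T k).comp (T l) = (T l).comp (T k)

/-- The unconditional approximation property with constant `C`. -/
def HasUAPWith (S : Set 𝕜) (X : Type*) [NormedAddCommGroup X] [NormedSpace 𝕜 X] (C : ℝ) : Prop :=
  ∃ T : ℕ → X →L[𝕜] X, IsApproxSeq T ∧ UncondBound S T C

/-- The metric unconditional approximation property. -/
def HasUMAP (S : Set 𝕜) (X : Type*) [NormedAddCommGroup X] [NormedSpace 𝕜 X] : Prop :=
  ∀ ε : ℝ, 0 < ε → HasUAPWith S X (1 + ε)

/-- `τ` is a vector space topology on `X`: addition, negation and multiplication by scalars are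
continuous. -/
def IsVectorTopology (𝕜 : Type*) [RCLike 𝕜] {X : Type*} [NormedAddCommGroup X] [NormedSpace 𝕜 X]
    (τ : TopologicalSpace X) : Prop :=
  @IsTopologicalAddGroup X τ _ ∧ @ContinuousSMul 𝕜 X _ _ τ

/-- The property `(u(τ))` of `τ`-unconditionality: the oscillation of `‖ε u + v j‖` over the signs
tends to `0` for every `u` and every norm bounded `τ`-null sequence `v`. -/
def TauUncond (S : Set 𝕜) (τ : TopologicalSpace X) : Prop :=
  ∀ (u : X) (v : ℕ → X), (∃ M : ℝ, ∀ j, ‖v j‖ ≤ M) → Tendsto v atTop (@nhds X τ 0) →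
    Tendsto (fun j => signOsc S (fun ε => ‖ε • u + v j‖)) atTop (𝓝 0)

/-- `T k x → x` in the vector space topology `τ`, uniformly for `x` in the unit ball. -/
def TendstoIdUniformlyOnBall (T : ℕ → X →L[𝕜] X) (τ : TopologicalSpace X) : Prop :=
  ∀ U ∈ @nhds X τ 0, ∀ᶠ k in atTop, ∀ x ∈ Metric.closedBall (0 : X) 1, T k x - x ∈ U

/-- The property `(u(T_k))` of block unconditionality: the elements of the break `T n B` and of the
tail `(Id - T m) B` are `ε`-almost unconditional, where `B` is the unit ball. -/
def BlockUncond (S : Set 𝕜) (T : ℕ → X →L[𝕜] X) : Prop :=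
  ∀ ε : ℝ, 0 < ε → ∀ n : ℕ, 1 ≤ n → ∃ m : ℕ, n ≤ m ∧
    ∀ x ∈ T n '' Metric.closedBall (0 : X) 1,
    ∀ y ∈ (ContinuousLinearMap.id 𝕜 X - T m) '' Metric.closedBall (0 : X) 1,
      signOsc S (fun δ => ‖δ • x + y‖) ≤ ε

/-- Unconditional skipped blocking decompositions. The indices start at `0` here:
`0 ≤ a 0 < b 0 < a 1 < b 1 < …`. -/
def HasUncondSkippedBlocking (S : Set 𝕜) (X : Type*) [NormedAddCommGroup X] [NormedSpace 𝕜 X] :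
    Prop :=
  ∀ ε : ℝ, 0 < ε → ∃ R : ℕ → X →L[𝕜] X, IsUncondApproxSeq S R ∧
    ∀ a b : ℕ → ℕ, (∀ k, a k < b k) → (∀ k, b k < a (k + 1)) →
    ∀ x : ℕ → X, (∀ k, x k ∈ Set.range (R (b k) - R (a k))) →
    ∀ (n : ℕ) (θ : ℕ → 𝕜), (∀ k, θ k ∈ S) →
      ‖∑ k ∈ Finset.range n, θ k • x k‖ ≤ (1 + ε) * ‖∑ k ∈ Finset.range n, x k‖

end Defs

/-- Finite cotype: for some `2 ≤ q < ∞` and some constant `C`,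
`(∑ ‖x i‖ ^ q) ^ (1 / q) ≤ C * average over all signs of ‖∑ ± x i‖`. -/
def HasFiniteCotype (X : Type*) [NormedAddCommGroup X] : Prop :=
  ∃ q : ℝ, 2 ≤ q ∧ ∃ C : ℝ, ∀ (n : ℕ) (x : Fin n → X),
    (∑ i, ‖x i‖ ^ q) ^ (1 / q) ≤
      C * ((∑ θ : Fin n → ℤˣ, ‖∑ i, (θ i : ℤ) • x i‖) / 2 ^ n)

/-! Only the group of signs matters, so both choices of `S` are treated together as an `IsSignSet`.

For (ii) ⇒ (i), take for τ the topology in which x tends to 0 when every `T n x` tends to 0 in norm.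
Commutation and finite rank give τ-uniform convergence on the ball. Conversely, if almost
unconditionality failed for infinitely many m, compactness of balls in a finite dimensional space
would produce one vector u and a bounded τ-null sequence contradicting (u(τ))
(`eventually_signOsc_le`). This gives more than (ii): every finite dimensional subspace and all
large m are covered.

For (iii), `exists_commuting_perturbation` replaces a subsequence of `T` by nearby operators with `R
k * R l = R l * R k = R k` for `k < l`. Ranges and kernels are then nested, so choosing each index
far enough out lets the signs be changed block by block, at the cost of a convergent product of
factors close to 1.

The hard point of (iv) ⇒ (ii) is commutation. Metric unconditionality gives finite rank `T k` with
`T m * T n = T n` for `n < m` and reflections `1 - 2 * T k` of norm at most 1 + η_k, with the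
product of these bounds at most 2. Hence all ordered products of reflections along increasing
indices are uniformly bounded. Expanding suitable products bounds sums of L operators `T (n i) * (1
- 2 * altSum T m i)` independently of L. Averaging over translates of m turns the alternating sums
into approximately 0 or P, where P is an average of the T's, so an average Q of L earlier operators
satisfies ‖Q(1 - P)‖ ≤ 12/L. The missing one-sided relation thus holds approximately, infinite
products make it asymptotically exact, and the perturbation lemma makes it exact. Averages keep the
asymptotic bounds on 1 + (ε - 1)T, from which unconditionality is rebuilt.

For (iii) ⇒ (iv), average N consecutive operators of a skipped blocking sequence. In each residue
class mod N, omitting one difference per period leaves skipped blocks. By unconditionality and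
cotype q, the omitted parts average O(N^(-1/q)), which is negligible for large N. -/

/-- A set of scalars of modulus one that is a group under multiplication and contains `-1`. -/
structure IsSignSet {𝕜 : Type*} [RCLike 𝕜] (S : Set 𝕜) : Prop where
  one_mem : (1 : 𝕜) ∈ S
  neg_mem : ∀ ε ∈ S, -ε ∈ S
  mul_mem : ∀ ε ∈ S, ∀ δ ∈ S, ε * δ ∈ S
  inv_mem : ∀ ε ∈ S, ε⁻¹ ∈ S
  norm_eq : ∀ ε ∈ S, ‖ε‖ = 1

theorem isSignSet_of_eq {𝕜 : Type*} [RCLike 𝕜] {S : Set 𝕜}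
    (hS : S = {1, -1} ∨ S = Metric.sphere (0 : 𝕜) 1) : IsSignSet S := by
  rcases hS with rfl | rfl
  · refine ⟨by simp, ?_, ?_, ?_, ?_⟩
    · rintro ε (rfl | rfl) <;> simp
    · rintro ε (rfl | rfl) δ (rfl | rfl) <;> simp
    · rintro ε (rfl | rfl) <;> simp [inv_neg]
    · rintro ε (rfl | rfl) <;> simp
  · refine ⟨by simp, ?_, ?_, ?_, ?_⟩ <;> simp +contextual

/-! ### Sign sets, oscillations and finite rank operators -/

section Basic

variable {𝕜 : Type*} [RCLike 𝕜] {X : Type*} [NormedAddCommGroup X] [NormedSpace 𝕜 X]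

theorem IsSignSet.neg_one_mem {S : Set 𝕜} (hS : IsSignSet S) : (-1 : 𝕜) ∈ S :=
  hS.neg_mem _ hS.one_mem

theorem IsSignSet.ne_zero {S : Set 𝕜} (hS : IsSignSet S) {ε : 𝕜} (h : ε ∈ S) : ε ≠ 0 := by
  intro h0
  have := hS.norm_eq ε h
  simp [h0] at this

theorem IsSignSet.norm_smul {S : Set 𝕜} (hS : IsSignSet S) {ε : 𝕜} (h : ε ∈ S) (x : X) :
    ‖ε • x‖ = ‖x‖ := by
  rw [_root_.norm_smul, hS.norm_eq ε h, one_mul]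

theorem signOsc_norm_le_iff {S : Set 𝕜} (hS : IsSignSet S) (x y : X) (c : ℝ) :
    signOsc S (fun δ => ‖δ • x + y‖) ≤ c ↔
      ∀ ε ∈ S, ∀ ε' ∈ S, ‖ε • x + y‖ ≤ ‖ε' • x + y‖ + c := by
  have hne : ((fun δ : 𝕜 => ‖δ • x + y‖) '' S).Nonempty := ⟨_, 1, hS.one_mem, rfl⟩
  have hba : BddAbove ((fun δ : 𝕜 => ‖δ • x + y‖) '' S) := by
    refine ⟨‖x‖ + ‖y‖, ?_⟩
    rintro _ ⟨δ, hδ, rfl⟩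
    exact (norm_add_le _ _).trans_eq (by rw [hS.norm_smul hδ])
  have hbb : BddBelow ((fun δ : 𝕜 => ‖δ • x + y‖) '' S) := by
    refine ⟨0, ?_⟩
    rintro _ ⟨δ, hδ, rfl⟩
    exact norm_nonneg _
  unfold signOsc
  constructor
  · intro h ε hε ε' hε'
    have h1 := le_csSup hba ⟨ε, hε, rfl⟩
    have h2 := csInf_le hbb ⟨ε', hε', rfl⟩
    simp only at h1 h2
    linarith
  · intro h
    rw [sub_le_iff_le_add]
    refine csSup_le hne ?_
    rintro _ ⟨ε, hε, rfl⟩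
    rw [← sub_le_iff_le_add']
    refine le_csInf hne ?_
    rintro _ ⟨ε', hε', rfl⟩
    have := h ε hε ε' hε'
    simp only
    linarith

theorem signOsc_norm_nonneg {S : Set 𝕜} (hS : IsSignSet S) (x y : X) :
    0 ≤ signOsc S (fun δ => ‖δ • x + y‖) := by
  have := (signOsc_norm_le_iff hS x y _).1 le_rfl 1 hS.one_mem 1 hS.one_mem
  linarith

/-- The oscillation of `‖δ x + y‖` is Lipschitz in `x` and `y`. -/
theorem signOsc_norm_le_of_near {S : Set 𝕜} (hS : IsSignSet S) (x y x' y' : X) :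
    signOsc S (fun δ => ‖δ • x + y‖) ≤
      signOsc S (fun δ => ‖δ • x' + y'‖) + 2 * (‖x - x'‖ + ‖y - y'‖) := by
  rw [signOsc_norm_le_iff hS]
  intro ε hε ε' hε'
  have h := (signOsc_norm_le_iff hS x' y' _).1 le_rfl ε hε ε' hε'
  have h1 : ‖ε • x + y‖ ≤ ‖ε • x' + y'‖ + (‖x - x'‖ + ‖y - y'‖) := by
    have : ε • x + y = ε • x' + y' + (ε • (x - x') + (y - y')) := by rw [smul_sub]; abel
    rw [this]
    refine (norm_add_le _ _).trans ?_
    gcongr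
    exact (norm_add_le _ _).trans_eq (by rw [hS.norm_smul hε])
  have h2 : ‖ε' • x' + y'‖ ≤ ‖ε' • x + y‖ + (‖x - x'‖ + ‖y - y'‖) := by
    have : ε' • x' + y' = ε' • x + y + (-(ε' • (x - x')) - (y - y')) := by rw [smul_sub]; abel
    rw [this]
    refine (norm_add_le _ _).trans ?_
    gcongr
    exact (norm_sub_le _ _).trans_eq (by rw [norm_neg, hS.norm_smul hε'])
  linarith

/-- The operators of an unconditional sequence are bounded by the unconditional constant. -/
theorem UncondBound.norm_le {S : Set 𝕜} (hS : IsSignSet S) {T : ℕ → X →L[𝕜] X} {C : ℝ}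
    (h : UncondBound S T C) (h0 : T 0 = 0) (n : ℕ) : ‖T n‖ ≤ C := by
  have := h n (fun _ => 1) (fun _ => hS.one_mem)
  simpa only [one_smul, Finset.sum_range_sub, h0, sub_zero] using this

/-- Choice of a sequence by recursion. -/
theorem exists_seq_of_step {α : Type*} (P : α → Prop) (r : ℕ → α → α → Prop) (a : α) (ha : P a)
    (step : ∀ k a, P a → ∃ b, P b ∧ r k a b) :
    ∃ f : ℕ → α, f 0 = a ∧ ∀ k, P (f k) ∧ r k (f k) (f (k + 1)) := by
  choose! g hg using step
  let f : ℕ → α := fun n => Nat.rec a (fun k b => g k b) n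
  have hf : ∀ k, P (f k) := by
    intro k
    induction k with
    | zero => exact ha
    | succ k ih => exact (hg k _ ih).1
  exact ⟨f, rfl, fun k => ⟨hf k, (hg k _ (hf k)).2⟩⟩

theorem tendsto_of_dense {T : ℕ → X →L[𝕜] X} {C : ℝ} (hC : ∀ k, ‖T k‖ ≤ C) {D : Set X}
    (hD : Dense D) (h : ∀ x ∈ D, Tendsto (fun k => T k x) atTop (𝓝 x)) (x : X) :
    Tendsto (fun k => T k x) atTop (𝓝 x) := by
  rw [Metric.tendsto_atTop]
  intro ε hε
  have hC0 : 0 ≤ C := (norm_nonneg _).trans (hC 0)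
  have hp : 0 < ε / (2 * (C + 1)) := by positivity
  obtain ⟨y, hy, hxy⟩ := hD.exists_dist_lt x hp
  obtain ⟨N, hN⟩ := Metric.tendsto_atTop.1 (h y hy) (ε / 2) (by positivity)
  refine ⟨N, fun n hn => ?_⟩
  have h1 := hN n hn
  rw [dist_eq_norm] at *
  have h2 : ‖T n (x - y)‖ ≤ C * ‖x - y‖ := (T n).le_of_opNorm_le (hC n) _
  have h3 : T n x - x = T n (x - y) + (T n y - y) - (x - y) := by rw [map_sub]; abel
  rw [h3]
  have h4 : (C + 1) * ‖x - y‖ < ε / 2 := by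
    calc (C + 1) * ‖x - y‖ < (C + 1) * (ε / (2 * (C + 1))) := by gcongr
      _ = ε / 2 := by field_simp
  calc _ ≤ ‖T n (x - y)‖ + ‖T n y - y‖ + ‖x - y‖ :=
        (norm_sub_le _ _).trans (by gcongr; exact norm_add_le _ _)
    _ < ε := by nlinarith

/-- Strong convergence to the identity is uniform on finite dimensional subspaces. -/
theorem eventually_norm_sub_le_of_finiteDimensional {T : ℕ → X →L[𝕜] X}
    (h : ∀ x, Tendsto (fun k => T k x) atTop (𝓝 x)) (F : Submodule 𝕜 X) [FiniteDimensional 𝕜 F]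
    {ε : ℝ} (hε : 0 < ε) : ∀ᶠ k in atTop, ∀ x ∈ F, ‖T k x - x‖ ≤ ε * ‖x‖ := by
  let b := Module.finBasis 𝕜 F
  obtain ⟨C, hC, hb⟩ := b.exists_opNorm_le (F := X)
  have : ∀ᶠ k in atTop, ∀ i, ‖T k (b i) - b i‖ ≤ ε / C := by
    rw [eventually_all]
    intro i
    have := (h (b i)).sub_const (b i : X)
    rw [sub_self] at this
    have h2 := this.norm
    rw [norm_zero] at h2
    exact h2.eventually_le_const (by positivity)
  filter_upwards [this] with k hk x hx
  have := hb (u := (T k - 1).comp F.subtypeL) (M := ε / C) (by positivity)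
    (fun i => by simpa using hk i)
  rw [mul_div_cancel₀ _ hC.ne'] at this
  simpa using ((T k - 1).comp F.subtypeL).le_of_opNorm_le this ⟨x, hx⟩

theorem tendsto_mul_of_finiteDimensional {T : ℕ → X →L[𝕜] X}
    (h : ∀ x, Tendsto (fun k => T k x) atTop (𝓝 x)) (K : X →L[𝕜] X)
    (hK : FiniteDimensional 𝕜 (LinearMap.range (K : X →ₗ[𝕜] X))) :
    Tendsto (fun k => (1 - T k) * K) atTop (𝓝 0) := by
  rw [tendsto_zero_iff_norm_tendsto_zero, Metric.tendsto_atTop]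
  intro ε hε
  obtain ⟨N, hN⟩ := eventually_atTop.1 (eventually_norm_sub_le_of_finiteDimensional h
    (LinearMap.range (K : X →ₗ[𝕜] X)) (ε := ε / (2 * (‖K‖ + 1))) (by positivity))
  refine ⟨N, fun n hn => ?_⟩
  have : ‖(1 - T n) * K‖ ≤ ε / (2 * (‖K‖ + 1)) * ‖K‖ := by
    refine ContinuousLinearMap.opNorm_le_bound _ (by positivity) fun x => ?_
    have := hN n hn (K x) ⟨x, rfl⟩
    rw [norm_sub_rev] at this
    refine this.trans ?_
    rw [mul_assoc]
    gcongr
    exact K.le_opNorm x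
  rw [Real.dist_eq, sub_zero, abs_of_nonneg (norm_nonneg _)]
  refine this.trans_lt ?_
  rw [div_mul_eq_mul_div, div_lt_iff₀ (by positivity)]
  nlinarith [norm_nonneg K]

theorem finiteDimensional_range_mul_left (A K : X →L[𝕜] X)
    (hK : FiniteDimensional 𝕜 (LinearMap.range (K : X →ₗ[𝕜] X))) :
    FiniteDimensional 𝕜 (LinearMap.range ((A * K : X →L[𝕜] X) : X →ₗ[𝕜] X)) := by
  have : LinearMap.range ((A * K : X →L[𝕜] X) : X →ₗ[𝕜] X) =
      (LinearMap.range (K : X →ₗ[𝕜] X)).map (A : X →ₗ[𝕜] X) := by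
    rw [← LinearMap.range_comp]; rfl
  rw [this]
  infer_instance

theorem finiteDimensional_range_mul_right (K A : X →L[𝕜] X)
    (hK : FiniteDimensional 𝕜 (LinearMap.range (K : X →ₗ[𝕜] X))) :
    FiniteDimensional 𝕜 (LinearMap.range ((K * A : X →L[𝕜] X) : X →ₗ[𝕜] X)) := by
  refine Submodule.finiteDimensional_of_le (S₂ := LinearMap.range (K : X →ₗ[𝕜] X)) ?_
  rintro _ ⟨x, rfl⟩
  exact ⟨A x, rfl⟩

theorem finiteDimensional_range_add (K A : X →L[𝕜] X)
    (hK : FiniteDimensional 𝕜 (LinearMap.range (K : X →ₗ[𝕜] X)))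
    (hA : FiniteDimensional 𝕜 (LinearMap.range (A : X →ₗ[𝕜] X))) :
    FiniteDimensional 𝕜 (LinearMap.range ((K + A : X →L[𝕜] X) : X →ₗ[𝕜] X)) := by
  refine Submodule.finiteDimensional_of_le
    (S₂ := LinearMap.range (K : X →ₗ[𝕜] X) ⊔ LinearMap.range (A : X →ₗ[𝕜] X)) ?_
  rintro _ ⟨x, rfl⟩
  exact Submodule.add_mem_sup ⟨x, rfl⟩ ⟨x, rfl⟩

theorem finiteDimensional_range_zero :
    FiniteDimensional 𝕜 (LinearMap.range ((0 : X →L[𝕜] X) : X →ₗ[𝕜] X)) := by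
  have : LinearMap.range ((0 : X →L[𝕜] X) : X →ₗ[𝕜] X) = ⊥ := LinearMap.range_zero
  rw [this]
  infer_instance

theorem finiteDimensional_range_sum {ι : Type*} (s : Finset ι) (c : ι → 𝕜) (K : ι → X →L[𝕜] X)
    (hK : ∀ i, FiniteDimensional 𝕜 (LinearMap.range (K i : X →ₗ[𝕜] X))) :
    FiniteDimensional 𝕜 (LinearMap.range ((∑ i ∈ s, c i • K i : X →L[𝕜] X) : X →ₗ[𝕜] X)) := by
  classical
  induction s using Finset.induction_on with
  | empty => exact finiteDimensional_range_zero
  | insert i s hi ih =>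
    rw [Finset.sum_insert hi]
    refine finiteDimensional_range_add _ _ ?_ ih
    have := finiteDimensional_range_mul_left (c i • 1) (K i) (hK i)
    rwa [smul_mul_assoc, one_mul] at this

theorem prod_one_add_le_exp (η : ℕ → ℝ) (hη : ∀ k, 0 ≤ η k) {c : ℝ}
    (h : ∀ s : Finset ℕ, ∑ k ∈ s, η k ≤ c) (s : Finset ℕ) :
    ∏ k ∈ s, (1 + η k) ≤ Real.exp c := by
  calc ∏ k ∈ s, (1 + η k) ≤ ∏ k ∈ s, Real.exp (η k) := by
        refine Finset.prod_le_prod (fun k _ => by linarith [hη k]) fun k _ => ?_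
        linarith [Real.add_one_le_exp (η k)]
    _ = Real.exp (∑ k ∈ s, η k) := (Real.exp_sum _ _).symm
    _ ≤ _ := Real.exp_le_exp.2 (h s)

theorem sum_geometric_le (c : ℝ) (hc : 0 ≤ c) (s : Finset ℕ) :
    ∑ k ∈ s, c * (1 / 2 : ℝ) ^ k ≤ 2 * c := by
  rw [← Finset.mul_sum]
  have := summable_geometric_two.sum_le_tsum s (fun _ _ => by positivity)
  rw [tsum_geometric_two] at this
  nlinarith

end Basic

/-! ### τ-unconditionality and block unconditionality -/

section Tau

variable {𝕜 : Type*} [RCLike 𝕜] {X : Type*} [NormedAddCommGroup X] [NormedSpace 𝕜 X]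

/-- The topology of convergence of all `T n x` in norm. -/
abbrev blockTopology (T : ℕ → X →L[𝕜] X) : TopologicalSpace X :=
  TopologicalSpace.induced (fun x n => T n x) (Pi.topologicalSpace (ι := ℕ) (Y := fun _ => X))

theorem isVectorTopology_blockTopology (T : ℕ → X →L[𝕜] X) :
    IsVectorTopology 𝕜 (blockTopology T) := by
  let L : X →ₗ[𝕜] (ℕ → X) := LinearMap.pi fun n => (T n : X →ₗ[𝕜] X)
  exact ⟨topologicalAddGroup_induced L, continuousSMul_induced L⟩

theorem tendsto_blockTopology_iff (T : ℕ → X →L[𝕜] X) {ι : Type*} (l : Filter ι) (v : ι → X) :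
    Tendsto v l (@nhds X (blockTopology T) 0) ↔ ∀ n, Tendsto (fun j => T n (v j)) l (𝓝 0) := by
  rw [blockTopology, nhds_induced, tendsto_comap_iff, tendsto_pi_nhds]
  simp

theorem tendstoIdUniformlyOnBall_iff (T : ℕ → X →L[𝕜] X) (τ : TopologicalSpace X) :
    TendstoIdUniformlyOnBall T τ ↔
      Tendsto (fun p : ℕ × X => T p.1 p.2 - p.2) (atTop ×ˢ 𝓟 (Metric.closedBall (0 : X) 1))
        (@nhds X τ 0) := by
  unfold TendstoIdUniformlyOnBall
  rw [Filter.tendsto_def]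
  refine forall₂_congr fun U hU => ?_
  exact (eventually_prod_principal_iff (p := fun p : ℕ × X => T p.1 p.2 - p.2 ∈ U)).symm

/-- By commutation `T n (T k x - x)` equals `-((1 - T k) * T n) x`, and `(1 - T k) * T n` tends to 0
in norm because strong convergence is uniform on bounded parts of the range of `T n`. -/
theorem tendstoIdUniformlyOnBall_blockTopology {T : ℕ → X →L[𝕜] X} (hT : IsApproxSeq T)
    (hc : IsCommutingSeq T) : TendstoIdUniformlyOnBall T (blockTopology T) := by
  rw [tendstoIdUniformlyOnBall_iff, tendsto_blockTopology_iff]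
  intro n
  have h := (tendsto_mul_of_finiteDimensional hT.tendsto (T n) (hT.finite_rank n)).norm
  rw [norm_zero] at h
  refine squeeze_zero_norm' ?_ (h.comp (tendsto_fst (g := 𝓟 (Metric.closedBall (0 : X) 1))))
  rw [eventually_prod_principal_iff]
  refine Eventually.of_forall fun k x hx => ?_
  have e : T n (T k x - x) = -(((1 - T k) * T n) x) := by
    have := DFunLike.congr_fun (hc n k) x
    simp only [ContinuousLinearMap.comp_apply] at this
    simp [this]
  simp only [e, norm_neg, Function.comp_apply]
  refine (ContinuousLinearMap.le_opNorm _ _).trans ?_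
  exact mul_le_of_le_one_right (norm_nonneg _) (by simpa using hx)

/-- The oscillation is homogeneous, so radius `M` costs no more than using `ε / M` on the unit ball.
-/
theorem BlockUncond.scale {S : Set 𝕜} (hS : IsSignSet S) {T : ℕ → X →L[𝕜] X}
    (h : BlockUncond S T) (M ε : ℝ) (hM : 0 < M) (hε : 0 < ε) (n : ℕ) (hn : 1 ≤ n) :
    ∃ m, n ≤ m ∧ ∀ x y : X, ‖x‖ ≤ M → ‖y‖ ≤ M →
      signOsc S (fun δ => ‖δ • T n x + (y - T m y)‖) ≤ ε := by
  obtain ⟨m, hm, H⟩ := h (ε / M) (by positivity) n hn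
  refine ⟨m, hm, fun x y hx hy => ?_⟩
  have hs : ∀ z : X, ‖z‖ ≤ M → ((M⁻¹ : ℝ) : 𝕜) • z ∈ Metric.closedBall (0 : X) 1 := by
    intro z hz
    rw [mem_closedBall_zero_iff, norm_smul, RCLike.norm_ofReal, abs_of_pos (by positivity),
      inv_mul_le_iff₀ hM, mul_one]
    exact hz
  have := H _ ⟨_, hs x hx, rfl⟩ _ ⟨_, hs y hy, rfl⟩
  rw [signOsc_norm_le_iff hS] at this ⊢
  intro a ha b hb
  have h2 := this a ha b hb
  have key : ∀ δ : 𝕜, δ • (T n) (((M⁻¹ : ℝ) : 𝕜) • x) +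
      (ContinuousLinearMap.id 𝕜 X - T m) (((M⁻¹ : ℝ) : 𝕜) • y) =
        ((M⁻¹ : ℝ) : 𝕜) • (δ • T n x + (y - T m y)) := by
    intro δ
    simp only [map_smul, smul_add, sub_apply, ContinuousLinearMap.id_apply]
    rw [smul_comm]
  rw [key, key, norm_smul, norm_smul, RCLike.norm_ofReal, abs_of_pos (by positivity)] at h2
  have h3 := mul_le_mul_of_nonneg_left h2 hM.le
  rw [mul_add, mul_inv_cancel_left₀ hM.ne', mul_inv_cancel_left₀ hM.ne',
    mul_div_cancel₀ _ hM.ne'] at h3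
  exact h3

/-- Replace u by the nearby `T n u`, then `v j` by `v j - T m (v j)`: the second error vanishes
since `T m (v j)` tends to 0 for the fixed m belonging to n. -/
theorem tauUncond_blockTopology {S : Set 𝕜} (hS : IsSignSet S) {T : ℕ → X →L[𝕜] X}
    (hT : IsApproxSeq T) (h : BlockUncond S T) : TauUncond S (blockTopology T) := by
  rintro u v ⟨M, hM⟩ hv
  rw [tendsto_blockTopology_iff] at hv
  rw [Metric.tendsto_atTop]
  intro ε hε
  have h1 : ∀ᶠ n in atTop, ‖u - T n u‖ < ε / 16 ∧ 1 ≤ n := by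
    refine Eventually.and ?_ (eventually_ge_atTop 1)
    have := (hT.tendsto u).const_sub u
    rw [sub_self] at this
    have := this.norm
    rw [norm_zero] at this
    exact this.eventually_lt_const (by positivity)
  obtain ⟨n, hn, hn1⟩ := h1.exists
  obtain ⟨m, -, H⟩ := h.scale hS (max (‖u‖ + 1) M) (ε / 2)
    (lt_max_of_lt_left (by positivity)) (by positivity) n hn1
  have h2 := (hv m).norm
  rw [norm_zero] at h2
  obtain ⟨N, hN⟩ := eventually_atTop.1 (h2.eventually_lt_const (show 0 < ε / 16 by positivity))
  refine ⟨N, fun j hj => ?_⟩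
  rw [Real.dist_eq, sub_zero, abs_of_nonneg (signOsc_norm_nonneg hS _ _)]
  have h3 := signOsc_norm_le_of_near hS u (v j) (T n u) (v j - T m (v j))
  have h4 := H u (v j) ((by linarith : ‖u‖ ≤ ‖u‖ + 1).trans (le_max_left _ _))
    ((hM j).trans (le_max_right _ _))
  have h5 := hN j hj
  rw [sub_sub_cancel] at h3
  linarith

/-- If the oscillation of `‖δ u + v j‖` vanishes along bounded sequences `v` tending to `l`, then
elements of a finite dimensional subspace and of a far tail are almost unconditional. -/
theorem eventually_signOsc_le {S : Set 𝕜} (hS : IsSignSet S) {l : Filter X}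
    (hl : ∀ (u : X) (v : ℕ → X), (∃ M : ℝ, ∀ j, ‖v j‖ ≤ M) → Tendsto v atTop l →
      Tendsto (fun j => signOsc S (fun ε => ‖ε • u + v j‖)) atTop (𝓝 0))
    {T : ℕ → X →L[𝕜] X} {C : ℝ} (hC : ∀ k, ‖T k‖ ≤ C)
    (ht : Tendsto (fun p : ℕ × X => p.2 - T p.1 p.2) (atTop ×ˢ 𝓟 (Metric.closedBall (0 : X) 1)) l)
    (F : Submodule 𝕜 X) [FiniteDimensional 𝕜 F] (r : ℝ) {ε : ℝ} (hε : 0 < ε) :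
    ∀ᶠ m in atTop, ∀ x ∈ F, ‖x‖ ≤ r → ∀ y : X, ‖y‖ ≤ 1 →
      signOsc S (fun δ => ‖δ • x + (y - T m y)‖) ≤ ε := by
  -- Bad indices m would form a subsequence with witnesses x in a compact ball of `F` and y in the
  -- unit ball. A further subsequence makes x converge to some u, while the tails stay bounded and
  -- tend to `l`.
  by_contra hcon
  rw [not_eventually] at hcon
  obtain ⟨φ, hφ, H⟩ := extraction_of_frequently_atTop hcon
  push Not at H
  choose x hxF hx y hy hosc using H
  have hcpt : IsCompact (Metric.closedBall (0 : F) r) := by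
    have : ProperSpace F := FiniteDimensional.proper 𝕜 F
    exact isCompact_closedBall _ _
  obtain ⟨u, -, ψ, hψ, hu⟩ := hcpt.tendsto_subseq (x := fun j => (⟨x j, hxF j⟩ : F))
    (fun j => by simpa using hx j)
  have hu' : Tendsto (fun j => x (ψ j)) atTop (𝓝 (u : X)) :=
    (continuous_subtype_val.tendsto u).comp hu
  have h1 : Tendsto (fun j => (φ (ψ j), y (ψ j))) atTop
      (atTop ×ˢ 𝓟 (Metric.closedBall (0 : X) 1)) := by
    refine Tendsto.prodMk (hφ.comp hψ).tendsto_atTop ?_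
    rw [tendsto_principal]
    exact Eventually.of_forall fun j => by simpa using hy (ψ j)
  have hlim := hl u (fun j => y (ψ j) - T (φ (ψ j)) (y (ψ j))) ⟨1 + C, fun j => ?_⟩ (ht.comp h1)
  · have h4 := (hu'.sub_const (u : X)).norm
    rw [sub_self, norm_zero] at h4
    obtain ⟨j, h5, h6⟩ := ((h4.eventually_lt_const (show 0 < ε / 4 by positivity)).and
      (hlim.eventually_lt_const (show 0 < ε / 4 by positivity))).exists
    have h7 := signOsc_norm_le_of_near hS (x (ψ j)) (y (ψ j) - T (φ (ψ j)) (y (ψ j))) u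
      (y (ψ j) - T (φ (ψ j)) (y (ψ j)))
    rw [sub_self, norm_zero] at h7
    have h8 := hosc (ψ j)
    linarith
  · refine (norm_sub_le _ _).trans (add_le_add (hy _) ?_)
    have := (T (φ (ψ j))).le_of_opNorm_le_of_le (hC _) (hy (ψ j))
    simpa using this

theorem TauUncond.eventually_signOsc_le {S : Set 𝕜} (hS : IsSignSet S) {T : ℕ → X →L[𝕜] X}
    {C : ℝ} (hC : ∀ k, ‖T k‖ ≤ C) (F : Submodule 𝕜 X) [FiniteDimensional 𝕜 F] (r : ℝ) {ε : ℝ}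
    (hε : 0 < ε) {τ : TopologicalSpace X} (hv : IsVectorTopology 𝕜 τ) (hτ : TauUncond S τ)
    (ht : TendstoIdUniformlyOnBall T τ) :
    ∀ᶠ m in atTop, ∀ x ∈ F, ‖x‖ ≤ r → ∀ y : X, ‖y‖ ≤ 1 →
      signOsc S (fun δ => ‖δ • x + (y - T m y)‖) ≤ ε := by
  refine _root_.eventually_signOsc_le hS (l := @nhds X τ 0) hτ hC ?_ F r hε
  rw [tendstoIdUniformlyOnBall_iff] at ht
  have h3 : Tendsto (fun z : X => -z) (@nhds X τ 0) (@nhds X τ 0) := by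
    have := (@continuous_neg X τ _ hv.1.toContinuousNeg).tendsto 0
    rwa [neg_zero] at this
  refine (h3.comp ht).congr fun p => ?_
  simp

theorem blockUncond_of_tauUncond {S : Set 𝕜} (hS : IsSignSet S) {T : ℕ → X →L[𝕜] X} {C : ℝ}
    (hT : IsApproxSeq T) (hC : ∀ k, ‖T k‖ ≤ C) {τ : TopologicalSpace X}
    (hv : IsVectorTopology 𝕜 τ) (hτ : TauUncond S τ) (ht : TendstoIdUniformlyOnBall T τ) :
    BlockUncond S T := by
  intro ε hε n _
  have := hT.finite_rank n
  obtain ⟨m, h, hm⟩ := ((hτ.eventually_signOsc_le hS hC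
    (LinearMap.range (T n : X →ₗ[𝕜] X)) C hε hv ht).and (eventually_ge_atTop n)).exists
  refine ⟨m, hm, ?_⟩
  rintro _ ⟨x, hx, rfl⟩ _ ⟨y, hy, rfl⟩
  refine h _ ⟨x, rfl⟩ ?_ y (by simpa using hy)
  have := (T n).le_of_opNorm_le_of_le (hC n) (mem_closedBall_zero_iff.1 hx)
  rwa [mul_one] at this

end Tau

/-! ### From almost commuting to commuting sequences -/

section Commuting

variable {𝕜 : Type*} [RCLike 𝕜] {X : Type*} [NormedAddCommGroup X] [NormedSpace 𝕜 X]

theorem exists_extension_of_finiteDimensional (F : Submodule 𝕜 X) [FiniteDimensional 𝕜 F]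
    (f : F →ₗ[𝕜] X) : ∃ H : X →L[𝕜] X, ∀ x : F, H x = f x := by
  have : FiniteDimensional 𝕜 (LinearMap.toContinuousLinearMap f).range :=
    LinearMap.finiteDimensional_range f
  obtain ⟨H, hH⟩ := (LinearMap.toContinuousLinearMap f).exist_extension_of_finiteDimensional_range
  refine ⟨H, fun x => ?_⟩
  exact (DFunLike.congr_fun hH x).symm

theorem exists_generalizedInverse (R : X →L[𝕜] X)
    (hR : FiniteDimensional 𝕜 (LinearMap.range (R : X →ₗ[𝕜] X))) :
    ∃ G : X →L[𝕜] X, R * G * R = R := by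
  obtain ⟨g, hg⟩ := (R : X →ₗ[𝕜] X).rangeRestrict.exists_rightInverse_of_surjective
    (LinearMap.range_rangeRestrict _)
  obtain ⟨G, hG⟩ := exists_extension_of_finiteDimensional _ g
  refine ⟨G, ?_⟩
  ext x
  have h1 := hG ((R : X →ₗ[𝕜] X).rangeRestrict x)
  have h2 := congrArg Subtype.val (DFunLike.congr_fun hg ((R : X →ₗ[𝕜] X).rangeRestrict x))
  simp only [LinearMap.comp_apply, LinearMap.id_apply] at h2
  change R (G (R x)) = R x
  have h3 : G (R x) = g ((R : X →ₗ[𝕜] X).rangeRestrict x) := h1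
  rw [h3]
  exact h2

theorem exists_leftInverse_on (A : X →L[𝕜] X) (F : Submodule 𝕜 X) [FiniteDimensional 𝕜 F]
    (hA : ∀ x ∈ F, A x = 0 → x = 0) : ∃ H : X →L[𝕜] X, ∀ x ∈ F, H (A x) = x := by
  let f : F →ₗ[𝕜] X := (A : X →ₗ[𝕜] X) ∘ₗ F.subtype
  have hf : Function.Injective f := by
    rw [← LinearMap.ker_eq_bot, LinearMap.ker_eq_bot']
    intro x hx
    exact Subtype.ext (hA x x.2 hx)
  let e := LinearEquiv.ofInjective f hf
  obtain ⟨H, hH⟩ := exists_extension_of_finiteDimensional (LinearMap.range f)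
    (F.subtype ∘ₗ (e.symm : LinearMap.range f →ₗ[𝕜] F))
  refine ⟨H, fun x hx => ?_⟩
  have := hH (e ⟨x, hx⟩)
  simp only [LinearMap.comp_apply, LinearEquiv.coe_coe, LinearEquiv.symm_apply_apply,
    Submodule.subtype_apply] at this
  exact this

theorem tendsto_mul_left_zero {A : X →L[𝕜] X} {M : ℕ → X →L[𝕜] X}
    (h : Tendsto (fun j => A * (1 - M j)) atTop (𝓝 0)) (B : X →L[𝕜] X) :
    Tendsto (fun j => B * A * (1 - M j)) atTop (𝓝 0) := by
  simpa [mul_assoc] using h.const_mul B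

theorem tendsto_add_left_zero {A B : X →L[𝕜] X} {M : ℕ → X →L[𝕜] X}
    (hA : Tendsto (fun j => A * (1 - M j)) atTop (𝓝 0))
    (hB : Tendsto (fun j => B * (1 - M j)) atTop (𝓝 0)) :
    Tendsto (fun j => (A + B) * (1 - M j)) atTop (𝓝 0) := by
  simpa [add_mul] using hA.add hB

/-- An almost commuting sequence has a small perturbation of one of its members that acts as the
identity on the range of `R` and modulo the kernel of `R`. -/
theorem exists_commuting_step {M : ℕ → X →L[𝕜] X}
    (hfin : ∀ k, FiniteDimensional 𝕜 (LinearMap.range (M k : X →ₗ[𝕜] X)))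
    (hM : ∀ x, Tendsto (fun k => M k x) atTop (𝓝 x))
    (hcom : ∀ i, Tendsto (fun j => M i * (1 - M j)) atTop (𝓝 0))
    (R : X →L[𝕜] X) (hR : FiniteDimensional 𝕜 (LinearMap.range (R : X →ₗ[𝕜] X)))
    (hRM : Tendsto (fun j => R * (1 - M j)) atTop (𝓝 0)) {δ : ℝ} (hδ : 0 < δ)
    {p : ℕ → Prop} (hp : ∀ᶠ m in atTop, p m) :
    ∃ (m : ℕ) (R' : X →L[𝕜] X), p m ∧
      FiniteDimensional 𝕜 (LinearMap.range (R' : X →ₗ[𝕜] X)) ∧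
      Tendsto (fun j => R' * (1 - M j)) atTop (𝓝 0) ∧
      R * R' = R ∧ R' * R = R ∧ ‖R' - M m‖ ≤ δ := by
  obtain ⟨G, hG⟩ := exists_generalizedInverse R hR
  obtain ⟨l, hl⟩ := (eventually_norm_sub_le_of_finiteDimensional hM
    (LinearMap.range (R : X →ₗ[𝕜] X)) (show (0 : ℝ) < 1 / 2 by norm_num)).exists
  -- `H * M l` serves as an identity on the range of `R`. A projection would also fix that range,
  -- but the right factor `M l` ensures that the product with `1 - M j` tends to 0, which the
  -- recursion needs.
  obtain ⟨H, hH⟩ := exists_leftInverse_on (M l) (LinearMap.range (R : X →ₗ[𝕜] X)) (by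
    intro x hx h0
    have := hl x hx
    rw [h0, zero_sub, norm_neg] at this
    exact norm_le_zero_iff.1 (by linarith))
  have hHR : H * M l * R = R := by
    ext x
    exact hH _ ⟨x, rfl⟩
  have hP := finiteDimensional_range_mul_left H (M l) (hfin l)
  have h1 : Tendsto (fun j => G * (R * (1 - M j)) + (1 - G * R) * ((1 - M j) * (H * M l))) atTop
      (𝓝 0) := by
    simpa using (hRM.const_mul G).add
      ((tendsto_mul_of_finiteDimensional hM (H * M l) hP).const_mul (1 - G * R))
  have h2 := h1.norm
  rw [norm_zero] at h2
  obtain ⟨m, hm, hpm⟩ := ((h2.eventually_le_const hδ).and hp).exists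
  -- The new operator corrects `1 - M m` on both sides: `R` kills `1 - G * R` from the left and `1 -
  -- H * M l` kills `R` from the left. This expansion displays finite rank and right factors that
  -- are all `R` or members of `M`.
  have e : 1 - (1 - G * R) * (1 - M m) * (1 - H * M l) =
      (M m + G * R) + (-(G * R)) * M m + (1 - G * R) * (1 - M m) * H * M l := by
    noncomm_ring
  refine ⟨m, 1 - (1 - G * R) * (1 - M m) * (1 - H * M l), hpm, ?_, ?_, ?_, ?_, ?_⟩
  · rw [e]
    exact finiteDimensional_range_add _ _ (finiteDimensional_range_add _ _
      (finiteDimensional_range_add _ _ (hfin m) (finiteDimensional_range_mul_left _ _ hR))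
      (finiteDimensional_range_mul_left _ _ (hfin m)))
      (finiteDimensional_range_mul_left _ _ (hfin l))
  · rw [e]
    exact tendsto_add_left_zero (tendsto_add_left_zero
      (tendsto_add_left_zero (hcom m) (tendsto_mul_left_zero hRM G))
      (tendsto_mul_left_zero (hcom m) _)) (tendsto_mul_left_zero (hcom l) _)
  · have : R * (1 - G * R) = 0 := by rw [mul_sub, ← mul_assoc, hG, mul_one, sub_self]
    rw [mul_sub, mul_one, ← mul_assoc, ← mul_assoc, this]
    simp
  · have : (1 - H * M l) * R = 0 := by rw [sub_mul, hHR, one_mul, sub_self]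
    rw [sub_mul, one_mul, mul_assoc, this]
    simp
  · have e' : 1 - (1 - G * R) * (1 - M m) * (1 - H * M l) - M m =
        G * (R * (1 - M m)) + (1 - G * R) * ((1 - M m) * (H * M l)) := by
      noncomm_ring
    rw [e']
    exact hm

/-- Almost commuting approximating sequences have small perturbations of subsequences that satisfy
`R k * R l = R l * R k = R (min k l)` for `k ≠ l`. -/
theorem exists_commuting_perturbation {M : ℕ → X →L[𝕜] X}
    (hfin : ∀ k, FiniteDimensional 𝕜 (LinearMap.range (M k : X →ₗ[𝕜] X)))
    (hM : ∀ x, Tendsto (fun k => M k x) atTop (𝓝 x))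
    (hcom : ∀ i, Tendsto (fun j => M i * (1 - M j)) atTop (𝓝 0))
    {δ : ℕ → ℝ} (hδ : ∀ k, 0 < δ k) (hδ0 : Tendsto δ atTop (𝓝 0))
    (p : ℕ → Submodule 𝕜 X → ℕ → Prop)
    (hp : ∀ k (F : Submodule 𝕜 X), FiniteDimensional 𝕜 F → ∀ᶠ m in atTop, p k F m) :
    ∃ (n : ℕ → ℕ) (R : ℕ → X →L[𝕜] X), n 0 = 0 ∧ StrictMono n ∧ IsApproxSeq R ∧
      (∀ k l, k < l → R k * R l = R k ∧ R l * R k = R k) ∧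
      (∀ k, ‖R (k + 1) - M (n (k + 1))‖ ≤ δ k) ∧
      ∀ k, p k (LinearMap.range (R k : X →ₗ[𝕜] X)) (n (k + 1)) := by
  obtain ⟨f, hf0, hf⟩ := exists_seq_of_step
    (fun a : ℕ × (X →L[𝕜] X) => FiniteDimensional 𝕜 (LinearMap.range (a.2 : X →ₗ[𝕜] X)) ∧
      Tendsto (fun j => a.2 * (1 - M j)) atTop (𝓝 0))
    (fun k a b => a.1 < b.1 ∧ a.2 * b.2 = a.2 ∧ b.2 * a.2 = a.2 ∧ ‖b.2 - M b.1‖ ≤ δ k ∧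
      p k (LinearMap.range (a.2 : X →ₗ[𝕜] X)) b.1)
    (0, 0) ⟨finiteDimensional_range_zero, by simp⟩ (by
      rintro k ⟨n, R⟩ ⟨hR, hRM⟩
      obtain ⟨m, R', ⟨hpm, hnm⟩, h1, h2, h3, h4, h5⟩ := exists_commuting_step hfin hM hcom R hR hRM
        (hδ k) ((hp k _ hR).and (eventually_gt_atTop n))
      exact ⟨(m, R'), ⟨h1, h2⟩, hnm, h3, h4, h5, hpm⟩)
  have hmono : StrictMono fun k => (f k).1 := strictMono_nat_of_lt_succ fun k => (hf k).2.1
  refine ⟨fun k => (f k).1, fun k => (f k).2, by simp [hf0], hmono,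
    ⟨by simp [hf0], fun k => (hf k).1.1, fun x => ?_⟩, ?_, fun k => (hf k).2.2.2.2.1,
    fun k => (hf k).2.2.2.2.2⟩
  · rw [← tendsto_add_atTop_iff_nat 1]
    have h1 : Tendsto (fun k => M (f (k + 1)).1 x) atTop (𝓝 x) :=
      (hM x).comp (hmono.tendsto_atTop.comp (tendsto_add_atTop_nat 1))
    have h2 : Tendsto (fun k => ((f (k + 1)).2 - M (f (k + 1)).1) x) atTop (𝓝 0) := by
      refine squeeze_zero_norm (a := fun k => δ k * ‖x‖) (fun k => ?_) ?_
      · exact ContinuousLinearMap.le_of_opNorm_le _ (hf k).2.2.2.2.1 x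
      · simpa using hδ0.mul_const ‖x‖
    have h3 := h1.add h2
    rw [add_zero] at h3
    refine h3.congr fun k => ?_
    simp
  · intro k l hkl
    induction l, hkl using Nat.le_induction with
    | base => exact ⟨(hf k).2.2.1, (hf k).2.2.2.1⟩
    | succ l hl ih =>
      have h1 := (hf l).2.2.1
      have h2 := (hf l).2.2.2.1
      constructor
      · calc (f k).2 * (f (l + 1)).2 = (f k).2 * (f l).2 * (f (l + 1)).2 := by rw [ih.1]
          _ = (f k).2 := by rw [mul_assoc, h1, ih.1]
      · calc (f (l + 1)).2 * (f k).2 = (f (l + 1)).2 * ((f l).2 * (f k).2) := by rw [ih.2]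
          _ = (f k).2 := by rw [← mul_assoc, h2, ih.2]

theorem isCommutingSeq_of_mul {R : ℕ → X →L[𝕜] X}
    (h : ∀ k l, k < l → R k * R l = R k ∧ R l * R k = R k) : IsCommutingSeq R := by
  intro k l
  change R k * R l = R l * R k
  rcases lt_trichotomy k l with hkl | rfl | hkl
  · rw [(h k l hkl).1, (h k l hkl).2]
  · rfl
  · rw [(h l k hkl).1, (h l k hkl).2]

end Commuting

/-! ### Skipped blocking decompositions -/

section Skipped

variable {𝕜 : Type*} [RCLike 𝕜] {X : Type*} [NormedAddCommGroup X] [NormedSpace 𝕜 X]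

/-- Each difference of the subsequence telescopes into original differences carrying the same sign.
-/
theorem UncondBound.subsequence {S : Set 𝕜} {T : ℕ → X →L[𝕜] X} {C : ℝ}
    (h : UncondBound S T C) {n : ℕ → ℕ} (hn : Monotone n) (hn0 : n 0 = 0) :
    UncondBound S (fun k => T (n k)) C := by
  have key : ∀ (N : ℕ) (θ : ℕ → 𝕜), (∀ k, θ k ∈ S) → ∃ φ : ℕ → 𝕜, (∀ k, φ k ∈ S) ∧
      ∑ i ∈ Finset.range (n N), φ i • (T (i + 1) - T i) =
        ∑ k ∈ Finset.range N, θ k • (T (n (k + 1)) - T (n k)) := by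
    intro N θ hθ
    induction N with
    | zero => exact ⟨θ, hθ, by simp [hn0]⟩
    | succ N ih =>
      obtain ⟨φ, hφ, e⟩ := ih
      refine ⟨fun i => if i < n N then φ i else θ N, fun k => ?_, ?_⟩
      · dsimp only
        split_ifs
        exacts [hφ k, hθ N]
      · rw [Finset.sum_range_succ, ← e, ← Finset.sum_range_add_sum_Ico _ (hn N.le_succ)]
        congr 1
        · refine Finset.sum_congr rfl fun i hi => ?_
          simp only [if_pos (Finset.mem_range.1 hi)]
        · rw [← Finset.sum_Ico_sub (fun i => T i) (hn N.le_succ), Finset.smul_sum]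
          refine Finset.sum_congr rfl fun i hi => ?_
          simp only [if_neg (not_lt.2 (Finset.mem_Ico.1 hi).1)]
  intro N θ hθ
  obtain ⟨φ, hφ, e⟩ := key N θ hθ
  rw [← e]
  exact h _ φ hφ

theorem UncondBound.perturbation {S : Set 𝕜} (hS : IsSignSet S) {T R : ℕ → X →L[𝕜] X} {C c : ℝ}
    (h : UncondBound S T C) (hc : 0 ≤ c) (hR : ∀ k, ‖R k - T k‖ ≤ c * (1 / 2) ^ k) :
    UncondBound S R (C + 4 * c) := by
  intro n θ hθ
  have e : ∑ k ∈ Finset.range n, θ k • (R (k + 1) - R k) =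
      ∑ k ∈ Finset.range n, θ k • (T (k + 1) - T k) +
        ∑ k ∈ Finset.range n, θ k • ((R (k + 1) - T (k + 1)) - (R k - T k)) := by
    rw [← Finset.sum_add_distrib]
    refine Finset.sum_congr rfl fun k _ => ?_
    rw [← smul_add]
    congr 1
    abel
  rw [e]
  refine (norm_add_le _ _).trans (add_le_add (h n θ hθ) ?_)
  calc _ ≤ ∑ k ∈ Finset.range n, 2 * c * (1 / 2 : ℝ) ^ k := by
        refine norm_sum_le_of_le _ fun k _ => ?_
        rw [norm_smul, hS.norm_eq _ (hθ k), one_mul]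
        refine (norm_sub_le _ _).trans ((add_le_add (hR (k + 1)) (hR k)).trans ?_)
        have : 0 ≤ c * (1 / 2 : ℝ) ^ k := by positivity
        rw [pow_succ]
        linarith
    _ ≤ 4 * c := by
        have := sum_geometric_le (2 * c) (by positivity) (Finset.range n)
        linarith

/-- Signs can be changed block by block when each initial segment is almost unconditional with
respect to the corresponding tail. -/
theorem norm_sum_sign_smul_le {S : Set 𝕜} (hS : IsSignSet S) {R : ℕ → X →L[𝕜] X}
    (hR : ∀ k l, k < l → R k * R l = R k ∧ R l * R k = R k) {c : ℝ} (hc : 0 ≤ c)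
    (hu : ∀ k, ∀ x ∈ LinearMap.range (R k : X →ₗ[𝕜] X), ∀ y, R (k + 1) y = 0 →
      ∀ ε ∈ S, ∀ ε' ∈ S, ‖ε • x + y‖ ≤ (1 + c * (1 / 2) ^ k) * ‖ε' • x + y‖)
    {a b : ℕ → ℕ} (hab : ∀ k, a k < b k) (hba : ∀ k, b k < a (k + 1)) (x : ℕ → X)
    (hx : ∀ k, x k ∈ Set.range (R (2 * b k) - R (2 * a k))) (n : ℕ) (θ : ℕ → 𝕜)
    (hθ : ∀ k, θ k ∈ S) :
    ‖∑ k ∈ Finset.range n, θ k • x k‖ ≤ Real.exp (2 * c) * ‖∑ k ∈ Finset.range n, x k‖ := by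
  have hb : StrictMono b := strictMono_nat_of_lt_succ fun k => (hba k).trans (hab _)
  have hmono : ∀ k l, k ≤ l →
      LinearMap.range (R k : X →ₗ[𝕜] X) ≤ LinearMap.range (R l : X →ₗ[𝕜] X) := by
    intro k l hkl
    rcases hkl.eq_or_lt with rfl | hkl
    · exact le_rfl
    · rintro _ ⟨z, rfl⟩
      exact ⟨R k z, DFunLike.congr_fun (hR k l hkl).2 z⟩
  have hxb : ∀ k, x k ∈ LinearMap.range (R (2 * b k) : X →ₗ[𝕜] X) := by
    intro k
    obtain ⟨w, hw⟩ := hx k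
    rw [← hw]
    have := hab k
    exact Submodule.sub_mem _ ⟨w, rfl⟩ (hmono (2 * a k) _ (by omega) ⟨w, rfl⟩)
  -- Doubling the indices makes room for `2 * b j + 1` strictly between `2 * b j` and `2 * a k`.
  have hker : ∀ j k, j < k → R (2 * b j + 1) (x k) = 0 := by
    intro j k hjk
    obtain ⟨w, hw⟩ := hx k
    have h1 : b j < a k := by
      obtain ⟨k, rfl⟩ : ∃ i, k = i + 1 := ⟨k - 1, by omega⟩
      exact (hb.monotone (by omega : j ≤ k)).trans_lt (hba k)
    have h2 := hab k
    have h3 := DFunLike.congr_fun (hR (2 * b j + 1) (2 * b k) (by omega)).1 w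
    have h4 := DFunLike.congr_fun (hR (2 * b j + 1) (2 * a k) (by omega)).1 w
    change R _ (R _ w) = R _ w at h3 h4
    rw [← hw, sub_apply, map_sub, h3, h4, sub_self]
  -- Invariant: the first j blocks carry their final signs and the whole tail one arbitrary common
  -- sign. In the inductive step the tail after block j changes its sign from `θ j` to `φ`, which
  -- costs one factor.
  have main : ∀ j ≤ n, ∀ φ ∈ S,
      ‖∑ k ∈ Finset.range j, θ k • x k + φ • ∑ k ∈ Finset.Ico j n, x k‖ ≤
        (∏ k ∈ Finset.range j, (1 + c * (1 / 2) ^ k)) * ‖∑ k ∈ Finset.range n, x k‖ := by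
    intro j
    induction j with
    | zero =>
      intro _ φ hφ
      simp [hS.norm_smul hφ]
    | succ j ih =>
      intro hj φ hφ
      set u := ∑ k ∈ Finset.range (j + 1), θ k • x k with hu_def
      set y := ∑ k ∈ Finset.Ico (j + 1) n, x k with hy_def
      have hum : u ∈ LinearMap.range (R (2 * b j) : X →ₗ[𝕜] X) := by
        refine Submodule.sum_mem _ fun k hk => Submodule.smul_mem _ _ (hmono _ _ ?_ (hxb k))
        have := hb.monotone (Nat.lt_succ_iff.1 (Finset.mem_range.1 hk))
        omega
      have hy : R (2 * b j + 1) y = 0 := by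
        rw [hy_def, map_sum]
        exact Finset.sum_eq_zero fun k hk => hker j k (Finset.mem_Ico.1 hk).1
      have flip : ∀ ψ ∈ S, ‖u + ψ • y‖ = ‖ψ⁻¹ • u + y‖ := by
        intro ψ hψ
        rw [← hS.norm_smul hψ (ψ⁻¹ • u + y), smul_add, smul_inv_smul₀ (hS.ne_zero hψ)]
      have h1 := hu (2 * b j) u hum y hy _ (hS.inv_mem φ hφ) _ (hS.inv_mem _ (hθ j))
      rw [← flip φ hφ, ← flip _ (hθ j)] at h1
      have h2 := ih (by omega) (θ j) (hθ j)
      rw [← Finset.sum_Ioo_add_eq_sum_Ico (by omega : j < n)] at h2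
      have h3 : u + θ j • y = ∑ k ∈ Finset.range j, θ k • x k +
          θ j • (∑ k ∈ Finset.Ioo j n, x k + x j) := by
        rw [hu_def, Finset.sum_range_succ, smul_add]
        have : Finset.Ioo j n = Finset.Ico (j + 1) n := by ext; simp
        rw [this, ← hy_def]
        abel
      rw [← h3] at h2
      have h4 : c * (1 / 2 : ℝ) ^ (2 * b j) ≤ c * (1 / 2 : ℝ) ^ j := by
        have := hb.le_apply (x := j)
        gcongr ?_ * ?_
        exact pow_le_pow_of_le_one (by norm_num) (by norm_num) (by omega)
      rw [Finset.prod_range_succ]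
      calc _ ≤ _ := h1
        _ ≤ (1 + c * (1 / 2) ^ j) * ((∏ k ∈ Finset.range j, (1 + c * (1 / 2) ^ k)) *
            ‖∑ k ∈ Finset.range n, x k‖) := by gcongr
        _ = _ := by ring
  have h := main n le_rfl 1 hS.one_mem
  rw [Finset.Ico_self, Finset.sum_empty, smul_zero, add_zero] at h
  refine h.trans ?_
  gcongr
  exact prod_one_add_le_exp _ (fun k => by positivity) (sum_geometric_le c hc) _

/-- Almost unconditional pairs in the unit ball are almost unconditional at every scale. -/
theorem norm_sign_smul_add_le {S : Set 𝕜} (hS : IsSignSet S) {A B : X →L[𝕜] X} {K η : ℝ}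
    (hK : ‖B‖ ≤ K) (hBA : B * A = A)
    (h : ∀ x ∈ LinearMap.range (A : X →ₗ[𝕜] X), ‖x‖ ≤ 1 → ∀ y, ‖y‖ ≤ 1 → B y = 0 →
      signOsc S (fun δ => ‖δ • x + y‖) ≤ η)
    {x : X} (hx : x ∈ LinearMap.range (A : X →ₗ[𝕜] X)) {y : X} (hy : B y = 0)
    {ε ε' : 𝕜} (hε : ε ∈ S) (hε' : ε' ∈ S) :
    ‖ε • x + y‖ ≤ (1 + (1 + K) * η) * ‖ε' • x + y‖ := by
  have hK0 : 0 ≤ K := (norm_nonneg _).trans hK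
  have hBx : B x = x := by
    obtain ⟨z, rfl⟩ := hx
    exact DFunLike.congr_fun hBA z
  set u := ε' • x + y with hu
  have hx' : ‖x‖ ≤ K * ‖u‖ := by
    rw [← hS.norm_smul hε' x]
    have : ε' • x = B u := by rw [hu, map_add, map_smul, hBx, hy, add_zero]
    rw [this]
    exact B.le_of_opNorm_le hK u
  have hy' : ‖y‖ ≤ (1 + K) * ‖u‖ := by
    have : y = u - ε' • x := by rw [hu]; abel
    rw [this]
    refine (norm_sub_le _ _).trans ?_
    rw [hS.norm_smul hε']
    linarith
  rcases (norm_nonneg u).eq_or_lt with h0 | h0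
  · have hx0 : x = 0 := norm_le_zero_iff.1 (by rw [← h0, mul_zero] at hx'; exact hx')
    have hy0 : y = 0 := norm_le_zero_iff.1 (by rw [← h0, mul_zero] at hy'; exact hy')
    rw [← h0, hx0, hy0]
    simp
  · have hM : 0 < (1 + K) * ‖u‖ := by positivity
    set M := (1 + K) * ‖u‖ with hMdef
    have hs : ∀ z : X, ‖z‖ ≤ M → ‖((M⁻¹ : ℝ) : 𝕜) • z‖ ≤ 1 := by
      intro z hz
      rw [norm_smul, RCLike.norm_ofReal, abs_of_pos (by positivity), inv_mul_le_iff₀ hM, mul_one]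
      exact hz
    have h1 := h _ (Submodule.smul_mem _ ((M⁻¹ : ℝ) : 𝕜) hx) (hs x (by linarith)) _ (hs y hy')
      (by rw [map_smul, hy, smul_zero])
    rw [signOsc_norm_le_iff hS] at h1
    have h2 := h1 ε hε ε' hε'
    have key : ∀ δ : 𝕜, δ • ((M⁻¹ : ℝ) : 𝕜) • x + ((M⁻¹ : ℝ) : 𝕜) • y =
        ((M⁻¹ : ℝ) : 𝕜) • (δ • x + y) := by
      intro δ
      rw [smul_add, smul_comm]
    rw [key, key, norm_smul, norm_smul, RCLike.norm_ofReal, abs_of_pos (by positivity)] at h2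
    have h3 := mul_le_mul_of_nonneg_left h2 hM.le
    rw [mul_add, mul_inv_cancel_left₀ hM.ne', mul_inv_cancel_left₀ hM.ne'] at h3
    calc _ ≤ _ := h3
      _ = _ := by rw [hMdef]; ring

/-- The index of each perturbed operator is chosen after the range of its predecessor, so that this
range is almost unconditional with respect to the next tail, with summable errors. Taking even
indices turns blocks with `b k < a (k + 1)` into blocks with room for an operator in between. -/
theorem hasUncondSkippedBlocking_of_tauUncond {S : Set 𝕜} (hS : IsSignSet S)
    {T : ℕ → X →L[𝕜] X} (hT : IsUncondApproxSeq S T) (hc : IsCommutingSeq T)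
    {τ : TopologicalSpace X} (hv : IsVectorTopology 𝕜 τ) (hτ : TauUncond S τ)
    (ht : TendstoIdUniformlyOnBall T τ) : HasUncondSkippedBlocking S X := by
  intro ε hε
  obtain ⟨hTa, C, hC⟩ := hT
  have hTn := hC.norm_le hS hTa.zero
  have hC0 : 0 ≤ C := (norm_nonneg _).trans (hTn 0)
  -- Here `C + 2` will bound the perturbed operators and `4 * c * (1 / 2) ^ k` the oscillations; the
  -- exponential bounds the product of all sign-change factors.
  obtain ⟨c, hc0, hc1, hce⟩ : ∃ c : ℝ, 0 < c ∧ c ≤ 1 ∧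
      Real.exp (2 * ((1 + (C + 2)) * (4 * c))) ≤ 1 + ε := by
    have hlog : 0 < Real.log (1 + ε) := Real.log_pos (by linarith)
    refine ⟨min 1 (Real.log (1 + ε) / (8 * (1 + (C + 2)))), by positivity, min_le_left _ _, ?_⟩
    rw [← Real.le_log_iff_exp_le (by positivity)]
    have := min_le_right 1 (Real.log (1 + ε) / (8 * (1 + (C + 2))))
    rw [le_div_iff₀ (by positivity)] at this
    linarith
  have hcom : ∀ i, Tendsto (fun j => T i * (1 - T j)) atTop (𝓝 0) := by
    intro i
    refine (tendsto_mul_of_finiteDimensional hTa.tendsto (T i) (hTa.finite_rank i)).congr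
      fun j => ?_
    have : T i * T j = T j * T i := hc i j
    rw [mul_sub, sub_mul, this, one_mul, mul_one]
  have hδ0 : Tendsto (fun k : ℕ => c * (1 / 2 : ℝ) ^ k) atTop (𝓝 0) := by
    simpa using (tendsto_pow_atTop_nhds_zero_of_lt_one (r := (1 / 2 : ℝ)) (by norm_num)
      (by norm_num)).const_mul c
  obtain ⟨n, R, hn0, hn, hRa, hR, hRT, hosc⟩ := exists_commuting_perturbation hTa.finite_rank
    hTa.tendsto hcom (δ := fun k => c * (1 / 2) ^ k) (fun k => by positivity) hδ0
    (fun k F m => ∀ x ∈ F, ‖x‖ ≤ 1 → ∀ y : X, ‖y‖ ≤ 1 →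
      signOsc S (fun δ => ‖δ • x + (y - T m y)‖) ≤ c * (1 / 2) ^ k)
    (fun k F hF => hτ.eventually_signOsc_le hS hTn F 1 (by positivity) hv ht)
  have hRT' : ∀ k, ‖R k - T (n k)‖ ≤ 2 * c * (1 / 2) ^ k := by
    intro k
    cases k with
    | zero => simp [hRa.zero, hn0, hTa.zero, hc0.le]
    | succ k =>
      refine (hRT k).trans_eq ?_
      rw [pow_succ]
      ring
  have hRn : ∀ k, ‖R k‖ ≤ C + 2 := by
    intro k
    have h1 : R k = T (n k) + (R k - T (n k)) := by abel
    rw [h1]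
    refine (norm_add_le _ _).trans (add_le_add (hTn _) ((hRT' k).trans ?_))
    have : (1 / 2 : ℝ) ^ k ≤ 1 := pow_le_one₀ (by norm_num) (by norm_num)
    nlinarith
  refine ⟨fun k => R (2 * k), ⟨⟨by simpa using hRa.zero, fun k => hRa.finite_rank _, fun x => ?_⟩,
    C + 4 * (2 * c), ?_⟩, ?_⟩
  · exact (hRa.tendsto x).comp (tendsto_id.const_mul_atTop' (by norm_num : 0 < 2))
  · exact ((hC.subsequence hn.monotone hn0).perturbation hS (by positivity) hRT').subsequence
      (n := fun k => 2 * k) (fun a b h => by dsimp only; omega) rfl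
  · intro a b hab hba x hx N θ hθ
    refine (norm_sum_sign_smul_le hS hR (c := (1 + (C + 2)) * (4 * c)) (by positivity) ?_ hab hba
      x hx N θ hθ).trans ?_
    · intro k x hx y hy ε hε ε' hε'
      have := norm_sign_smul_add_le hS (hRn (k + 1)) (η := 4 * c * (1 / 2) ^ k)
        (hR k (k + 1) (by omega)).2 ?_ hx hy hε hε'
      · refine this.trans_eq ?_
        ring
      · intro x hx hx1 y hy1 hy
        -- Since `R (k + 1)` kills y, y is within `c * (1 / 2) ^ k` of the tail vector of `T`.
        -- Replacing it costs twice this, so the total oscillation is at most 3c/2^k, below the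
        -- allowed 4c/2^k.
        have h1 := signOsc_norm_le_of_near hS x y x (y - T (n (k + 1)) y)
        have h2 := hosc k x hx hx1 y hy1
        have h3 : ‖y - (y - T (n (k + 1)) y)‖ ≤ c * (1 / 2) ^ k := by
          have : y - (y - T (n (k + 1)) y) = -((R (k + 1) - T (n (k + 1))) y) := by
            rw [sub_apply, hy]
            abel
          rw [this, norm_neg]
          simpa using ContinuousLinearMap.le_of_opNorm_le_of_le _ (hRT k) hy1
        rw [sub_self, norm_zero] at h1
        have : 0 ≤ c * (1 / 2 : ℝ) ^ k := by positivity
        linarith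
    · gcongr

end Skipped

/-! ### Products of reflections and averages along progressions -/

section Averages

variable {𝕜 : Type*} [RCLike 𝕜] {X : Type*} [NormedAddCommGroup X] [NormedSpace 𝕜 X]

/-- The alternating sum `T (p (r - 1)) - T (p (r - 2)) + ⋯ ± T (p 0)`. -/
def altSum (T : ℕ → X →L[𝕜] X) (p : ℕ → ℕ) : ℕ → X →L[𝕜] X
  | 0 => 0
  | r + 1 => T (p r) - altSum T p r

theorem altSum_two_mul (T : ℕ → X →L[𝕜] X) (p : ℕ → ℕ) (L : ℕ) :
    altSum T p (2 * L) = ∑ k ∈ Finset.range L, (T (p (2 * k + 1)) - T (p (2 * k))) := by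
  induction L with
  | zero => simp [altSum]
  | succ L ih =>
    rw [Finset.sum_range_succ, ← ih]
    change T (p (2 * L + 1)) - (T (p (2 * L)) - altSum T p (2 * L)) = _
    abel

theorem norm_le_of_one_sub_two_mul {A : X →L[𝕜] X} {c : ℝ} (h : ‖1 - 2 * A‖ ≤ c) :
    ‖A‖ ≤ (1 + c) / 2 := by
  have h1 : (2 : 𝕜) • A = 1 - (1 - 2 * A) := by
    rw [two_smul, two_mul]
    abel
  have h2 : ‖(2 : 𝕜) • A‖ ≤ 1 + c := by
    rw [h1]
    exact (norm_sub_le _ _).trans (add_le_add ContinuousLinearMap.norm_id_le h)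
  rw [norm_smul, RCLike.norm_two] at h2
  linarith

theorem prod_comp_le {η : ℕ → ℝ} {c : ℝ} (h : ∀ s : Finset ℕ, ∏ k ∈ s, (1 + η k) ≤ c) {p : ℕ → ℕ}
    (hp : StrictMono p) (r : ℕ) : ∏ i ∈ Finset.range r, (1 + η (p i)) ≤ c := by
  rw [← Finset.prod_image (f := fun k => 1 + η k) (hp.injective.injOn)]
  exact h _

/-- A sequence of operators with `T m * T n = T n` for `n < m` whose reflections `1 - 2 T k` are
almost contractive. -/
structure IsReflectionChain (T : ℕ → X →L[𝕜] X) (η : ℕ → ℝ) : Prop where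
  mul_eq : ∀ n m, n < m → T m * T n = T n
  nonneg : ∀ k, 0 ≤ η k
  norm_reflection_le : ∀ k, ‖1 - 2 * T k‖ ≤ 1 + η k
  prod_le : ∀ s : Finset ℕ, ∏ k ∈ s, (1 + η k) ≤ 2

namespace IsReflectionChain

variable {T : ℕ → X →L[𝕜] X} {η : ℕ → ℝ} (h : IsReflectionChain T η)
include h

theorem mul_altSum (p : ℕ → ℕ) (r m : ℕ) (hm : ∀ i < r, p i < m) :
    T m * altSum T p r = altSum T p r := by
  induction r with
  | zero => simp [altSum]
  | succ r ih =>
    rw [altSum, mul_sub, h.mul_eq _ _ (hm r (by omega)), ih fun i hi => hm i (by omega)]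

/-- `T (p r)` fixes the earlier alternating sum, so the mixed term of the product only reverses its
sign. Hence `1 - 2 * altSum` is an ordered product of reflections, with norm bounded by the product
of their bounds. -/
theorem one_sub_altSum_succ {p : ℕ → ℕ} (hp : StrictMono p) (r : ℕ) :
    1 - 2 * altSum T p (r + 1) = (1 - 2 * T (p r)) * (1 - 2 * altSum T p r) := by
  have h1 := h.mul_altSum p r (p r) fun i hi => hp hi
  calc 1 - 2 * altSum T p (r + 1) = 1 - 2 * (T (p r) - altSum T p r) := rfl
    _ = 1 - 2 * T (p r) - 2 * altSum T p r + 4 * (T (p r) * altSum T p r) := by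
      rw [h1]
      noncomm_ring
    _ = _ := by noncomm_ring

theorem norm_one_sub_altSum_le {p : ℕ → ℕ} (hp : StrictMono p) (r : ℕ) :
    ‖1 - 2 * altSum T p r‖ ≤ ∏ i ∈ Finset.range r, (1 + η (p i)) := by
  induction r with
  | zero =>
    simp only [altSum, mul_zero, sub_zero, Finset.range_zero, Finset.prod_empty]
    exact ContinuousLinearMap.norm_id_le
  | succ r ih =>
    rw [h.one_sub_altSum_succ hp, Finset.prod_range_succ, mul_comm (∏ i ∈ _, _)]
    exact (norm_mul_le _ _).trans (mul_le_mul (h.norm_reflection_le _) ih (norm_nonneg _)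
      (by linarith [h.nonneg (p r)]))

theorem norm_altSum_le {p : ℕ → ℕ} (hp : StrictMono p) (r : ℕ) : ‖altSum T p r‖ ≤ 3 / 2 := by
  have := norm_le_of_one_sub_two_mul
    ((h.norm_one_sub_altSum_le hp r).trans (prod_comp_le h.prod_le hp r))
  linarith

theorem norm_le (k : ℕ) : ‖T k‖ ≤ 3 / 2 := by
  have h1 := h.prod_le {k}
  rw [Finset.prod_singleton] at h1
  have := norm_le_of_one_sub_two_mul ((h.norm_reflection_le k).trans h1)
  linarith

/-- The operator is the product of the pairs `(1 - 2 * T (m i)) * (1 - 2 * T (n i))`, later pairs on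
the left. The chain relation simplifies every product with the larger index on the left; the
products `T (n i) * altSum T m i` remain and are what is to be controlled. -/
theorem norm_word_le {n m : ℕ → ℕ} (hn : StrictMono n) (hm : StrictMono m) (N : ℕ)
    (hnm : ∀ i < N, n i < m i) :
    ‖(1 - 2 * altSum T m N) + 2 * ∑ i ∈ Finset.range N, T (n i) * (1 - 2 * altSum T m i)‖ ≤
      (∏ i ∈ Finset.range N, (1 + η (n i))) * ∏ i ∈ Finset.range N, (1 + η (m i)) := by
  induction N with
  | zero =>
    simp only [altSum, mul_zero, sub_zero, Finset.range_zero, Finset.prod_empty,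
      Finset.sum_empty, add_zero, mul_one]
    exact ContinuousLinearMap.norm_id_le
  | succ N ih =>
    have ih := ih fun i hi => hnm i (by omega)
    set V := 1 - 2 * altSum T m N with hV
    set W := ∑ i ∈ Finset.range N, T (n i) * (1 - 2 * altSum T m i) with hW
    have hNW : T (n N) * W = W := by
      rw [hW, Finset.mul_sum]
      refine Finset.sum_congr rfl fun i hi => ?_
      rw [← mul_assoc, h.mul_eq _ _ (hn (Finset.mem_range.1 hi))]
    have hMN := h.mul_eq _ _ (hnm N (by omega))
    have hMW : T (m N) * W = W := by
      rw [← hNW, ← mul_assoc, hMN]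
    have e : (1 - 2 * altSum T m (N + 1)) +
        2 * ∑ i ∈ Finset.range (N + 1), T (n i) * (1 - 2 * altSum T m i) =
        (1 - 2 * T (n N) + 0 - 2 * T (m N) + 4 * (T (m N) * T (n N))) * (V + 2 * W) := by
      have e1 : (1 - 2 * T (n N) + 0 - 2 * T (m N) + 4 * (T (m N) * T (n N))) * (V + 2 * W) =
          V + 2 * W - 2 * (T (n N) * V) - 4 * (T (n N) * W) - 2 * (T (m N) * V)
            - 4 * (T (m N) * W) + 4 * (T (m N) * T (n N) * V)
            + 8 * (T (m N) * (T (n N) * W)) := by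
        noncomm_ring
      rw [e1, hMN, hNW, hMW, h.one_sub_altSum_succ hm, Finset.sum_range_succ, ← hV, ← hW]
      noncomm_ring
    have e2 : (1 - 2 * T (n N) + 0 - 2 * T (m N) + 4 * (T (m N) * T (n N))) =
        (1 - 2 * T (m N)) * (1 - 2 * T (n N)) := by
      noncomm_ring
    rw [e, e2, Finset.prod_range_succ, Finset.prod_range_succ]
    have h1 := h.norm_reflection_le (n N)
    have h2 := h.norm_reflection_le (m N)
    have h3 := h.nonneg (n N)
    have h4 := h.nonneg (m N)
    calc _ ≤ ‖1 - 2 * T (m N)‖ * ‖1 - 2 * T (n N)‖ * ‖V + 2 * W‖ :=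
          (norm_mul_le _ _).trans (by gcongr; exact norm_mul_le _ _)
      _ ≤ (1 + η (m N)) * (1 + η (n N)) *
          ((∏ i ∈ Finset.range N, (1 + η (n i))) * ∏ i ∈ Finset.range N, (1 + η (m i))) := by
        gcongr
      _ = _ := by ring

theorem norm_sum_mul_altSum_le {n m : ℕ → ℕ} (hn : StrictMono n) (hm : StrictMono m) (N : ℕ)
    (hnm : ∀ i < N, n i < m i) :
    ‖∑ i ∈ Finset.range N, T (n i) * (1 - 2 * altSum T m i)‖ ≤ 3 := by
  have h1 := h.norm_word_le hn hm N hnm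
  have h2 := (h.norm_one_sub_altSum_le hm N).trans (prod_comp_le h.prod_le hm N)
  have h3 : (∏ i ∈ Finset.range N, (1 + η (n i))) * ∏ i ∈ Finset.range N, (1 + η (m i)) ≤ 2 * 2 :=
    mul_le_mul (prod_comp_le h.prod_le hn N) (prod_comp_le h.prod_le hm N)
      (Finset.prod_nonneg fun i _ => by linarith [h.nonneg (m i)]) (by norm_num)
  set W := ∑ i ∈ Finset.range N, T (n i) * (1 - 2 * altSum T m i)
  set V := 1 - 2 * altSum T m N
  have h4 : (2 : 𝕜) • W = V + 2 * W - V := by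
    rw [two_smul, two_mul]
    abel
  have h5 : ‖(2 : 𝕜) • W‖ ≤ 2 * 2 + 2 := by
    rw [h4]
    exact (norm_sub_le _ _).trans (add_le_add (h1.trans h3) h2)
  rw [norm_smul, RCLike.norm_two] at h5
  linarith

end IsReflectionChain

/-- The average of the first `L` terms of a sequence. -/
noncomputable def average {E : Type*} [AddCommMonoid E] [Module 𝕜 E] (f : ℕ → E) (L : ℕ) : E :=
  (L : 𝕜)⁻¹ • ∑ l ∈ Finset.range L, f l

theorem norm_average_le {E : Type*} [NormedAddCommGroup E] [NormedSpace 𝕜 E] {f : ℕ → E} {c : ℝ}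
    (hc : 0 ≤ c) {L : ℕ} (hf : ∀ l < L, ‖f l‖ ≤ c) : ‖average (𝕜 := 𝕜) f L‖ ≤ c := by
  rw [average, norm_smul, norm_inv, RCLike.norm_natCast]
  have h1 : ‖∑ l ∈ Finset.range L, f l‖ ≤ L * c := by
    refine (norm_sum_le_of_le _ fun l hl => hf l (Finset.mem_range.1 hl)).trans_eq ?_
    simp
  rcases Nat.eq_zero_or_pos L with rfl | hL
  · simpa using hc
  · rw [inv_mul_le_iff₀ (by positivity)]
    exact h1

theorem average_const {E : Type*} [AddCommMonoid E] [Module 𝕜 E] (x : E) {L : ℕ} (hL : 0 < L) :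
    average (𝕜 := 𝕜) (fun _ => x) L = x := by
  have : (L : 𝕜) ≠ 0 := Nat.cast_ne_zero.2 hL.ne'
  rw [average, Finset.sum_const, Finset.card_range, ← Nat.cast_smul_eq_nsmul 𝕜, inv_smul_smul₀ this]

theorem average_sub {E : Type*} [AddCommGroup E] [Module 𝕜 E] (f g : ℕ → E) (L : ℕ) :
    average (𝕜 := 𝕜) (fun l => f l - g l) L = average (𝕜 := 𝕜) f L - average (𝕜 := 𝕜) g L := by
  rw [average, Finset.sum_sub_distrib, smul_sub]; rfl

theorem average_add {E : Type*} [AddCommMonoid E] [Module 𝕜 E] (f g : ℕ → E) (L : ℕ) :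
    average (𝕜 := 𝕜) (fun l => f l + g l) L = average (𝕜 := 𝕜) f L + average (𝕜 := 𝕜) g L := by
  rw [average, Finset.sum_add_distrib, smul_add]; rfl

theorem average_mul_left (A : X →L[𝕜] X) (f : ℕ → X →L[𝕜] X) (L : ℕ) :
    average (𝕜 := 𝕜) (fun l => A * f l) L = A * average (𝕜 := 𝕜) f L := by
  rw [average, ← Finset.mul_sum, average, mul_smul_comm]

theorem average_sum {E : Type*} [AddCommMonoid E] [Module 𝕜 E] (f : ℕ → ℕ → E) (s : Finset ℕ)
    (L : ℕ) : average (𝕜 := 𝕜) (fun l => ∑ i ∈ s, f i l) L = ∑ i ∈ s, average (𝕜 := 𝕜) (f i) L := by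
  simp only [average]
  rw [Finset.sum_comm, Finset.smul_sum]

/-- The average of `T` along `L` terms of the progression `q, q + s, q + 2 s, …`. -/
noncomputable def progAverage (T : ℕ → X →L[𝕜] X) (q s L : ℕ) : X →L[𝕜] X :=
  average (𝕜 := 𝕜) (fun l => T (q + s * l)) L

namespace IsReflectionChain

variable {T : ℕ → X →L[𝕜] X} {η : ℕ → ℝ} (h : IsReflectionChain T η)
include h

theorem norm_progAverage_le (q s L : ℕ) : ‖progAverage T q s L‖ ≤ 3 / 2 :=
  norm_average_le (by norm_num) fun _ _ => h.norm_le _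

/-- Interleaving the two progressions gives a strictly increasing sequence, and the difference of
the averages is its alternating sum divided by L. -/
theorem norm_progAverage_sub_le {q s i L : ℕ} (hi : i < s) :
    ‖progAverage T (q + i) s L - progAverage T q s L‖ ≤ 3 / 2 / L := by
  rcases Nat.eq_zero_or_pos i with rfl | hi0
  · simp only [add_zero, sub_self, norm_zero]
    positivity
  · let p : ℕ → ℕ := fun j => q + s * (j / 2) + i * (j % 2)
    have hp : StrictMono p := by
      refine strictMono_nat_of_lt_succ fun j => ?_
      rcases Nat.even_or_odd' j with ⟨k, rfl | rfl⟩
      · have h1 : 2 * k / 2 = k := by omega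
        have h2 : (2 * k + 1) / 2 = k := by omega
        have h3 : 2 * k % 2 = 0 := by omega
        have h4 : (2 * k + 1) % 2 = 1 := by omega
        simp only [p, h1, h2, h3, h4]
        omega
      · have h1 : (2 * k + 1 + 1) / 2 = k + 1 := by omega
        have h2 : (2 * k + 1) / 2 = k := by omega
        have h3 : (2 * k + 1 + 1) % 2 = 0 := by omega
        have h4 : (2 * k + 1) % 2 = 1 := by omega
        simp only [p, h1, h2, h3, h4, mul_add]
        omega
    have e : progAverage T (q + i) s L - progAverage T q s L = (L : 𝕜)⁻¹ • altSum T p (2 * L) := by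
      rw [progAverage, progAverage, ← average_sub, average, altSum_two_mul]
      congr 1
      refine Finset.sum_congr rfl fun k _ => ?_
      have h1 : 2 * k / 2 = k := by omega
      have h2 : (2 * k + 1) / 2 = k := by omega
      have h3 : 2 * k % 2 = 0 := by omega
      have h4 : (2 * k + 1) % 2 = 1 := by omega
      simp only [p, h1, h2, h3, h4, mul_one, mul_zero, add_zero]
      rw [add_right_comm]
    rw [e, norm_smul, norm_inv, RCLike.norm_natCast, div_eq_inv_mul]
    gcongr
    exact h.norm_altSum_le hp _

/-- Averages of alternating sums are close to `0` or to a single average, by parity. -/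
theorem norm_average_altSum_le {q s L : ℕ} (k : ℕ) (hk : 2 * k < s) :
    ‖average (𝕜 := 𝕜) (fun l => altSum T (fun i => q + s * l + i) (2 * k)) L‖ ≤
        2 * k * (3 / 2 / L) ∧
      ‖average (𝕜 := 𝕜) (fun l => altSum T (fun i => q + s * l + i) (2 * k + 1)) L -
        progAverage T q s L‖ ≤ (2 * k + 1) * (3 / 2 / L) := by
  have hsucc : ∀ i, average (𝕜 := 𝕜) (fun l => altSum T (fun i => q + s * l + i) (i + 1)) L =
      progAverage T (q + i) s L -
        average (𝕜 := 𝕜) (fun l => altSum T (fun i => q + s * l + i) i) L := by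
    intro i
    rw [progAverage, ← average_sub]
    congr 1
    ext1 l
    rw [altSum, add_right_comm]
  have step : ∀ k, 2 * k < s →
      ‖average (𝕜 := 𝕜) (fun l => altSum T (fun i => q + s * l + i) (2 * k)) L‖ ≤
        2 * k * (3 / 2 / L) →
      ‖average (𝕜 := 𝕜) (fun l => altSum T (fun i => q + s * l + i) (2 * k + 1)) L -
        progAverage T q s L‖ ≤ (2 * k + 1) * (3 / 2 / L) := by
    intro k hk h1
    rw [hsucc, sub_right_comm]
    refine (norm_sub_le _ _).trans ?_
    have := h.norm_progAverage_sub_le (q := q) (L := L) hk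
    linarith
  induction k with
  | zero =>
    have h0 : ‖average (𝕜 := 𝕜) (fun l => altSum T (fun i => q + s * l + i) (2 * 0)) L‖ ≤
        2 * ((0 : ℕ) : ℝ) * (3 / 2 / L) := by
      simp [average, altSum]
    exact ⟨h0, step 0 hk h0⟩
  | succ k ih =>
    obtain ⟨-, h2⟩ := ih (by omega)
    have h3 : ‖average (𝕜 := 𝕜) (fun l => altSum T (fun i => q + s * l + i) (2 * (k + 1))) L‖ ≤
        2 * ((k + 1 : ℕ) : ℝ) * (3 / 2 / L) := by
      rw [show 2 * (k + 1) = 2 * k + 1 + 1 by ring, hsucc,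
        ← sub_sub_sub_cancel_right _ _ (progAverage T q s L)]
      refine (norm_sub_le _ _).trans ?_
      have := h.norm_progAverage_sub_le (q := q) (L := L) (i := 2 * k + 1) (s := s) (by omega)
      push_cast
      linarith
    exact ⟨h3, step _ hk h3⟩

/-- This is the approximate relation in the direction the chain does not provide. A sum of 2L terms
is bounded independently of L; after averaging, its odd terms contain 1 - 2P and its even terms are
nearly `T (n i)`, so an alternating sum relates it to L copies of the left side. The condition `L ^
2 ≤ L'` keeps the accumulated averaging error bounded. -/
theorem norm_progAverage_mul_one_sub_le {B t L q s L' : ℕ} (ht : 0 < t) (hL : 0 < L)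
    (hLL : L ^ 2 ≤ L') (hs : 2 * L ≤ s) (hq : B + t * (2 * L) ≤ q) :
    ‖progAverage T (B + t) (2 * t) L * (1 - progAverage T q s L')‖ ≤ 12 / L := by
  let n : ℕ → ℕ := fun i => B + t * i
  have hn : StrictMono n := fun i j hij => by
    have := Nat.mul_lt_mul_of_pos_left hij ht
    simp only [n]
    omega
  have hL' : 0 < L' := lt_of_lt_of_le (by positivity) hLL
  let A : ℕ → X →L[𝕜] X := fun i =>
    average (𝕜 := 𝕜) (fun l => altSum T (fun i => q + s * l + i) i) L'
  set P := progAverage T q s L' with hP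
  have h1 : ‖∑ i ∈ Finset.range (2 * L), T (n i) * (1 - 2 * A i)‖ ≤ 3 := by
    have e : ∑ i ∈ Finset.range (2 * L), T (n i) * (1 - 2 * A i) =
        average (𝕜 := 𝕜) (fun l => ∑ i ∈ Finset.range (2 * L),
          T (n i) * (1 - 2 * altSum T (fun i => q + s * l + i) i)) L' := by
      rw [average_sum]
      refine Finset.sum_congr rfl fun i _ => ?_
      rw [average_mul_left, average_sub, average_const _ hL', average_mul_left]
    rw [e]
    refine norm_average_le (by norm_num) fun l _ => ?_
    refine h.norm_sum_mul_altSum_le hn (fun i j hij => by simpa using hij) _ fun i hi => ?_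
    have := Nat.mul_lt_mul_of_pos_left hi ht
    simp only [n]
    omega
  have h2 := h.norm_altSum_le hn (2 * L)
  -- In each pair, T_even + T_odd(1 - 2P) plus T_odd - T_even equals 2 T_odd(1 - P). The last sum
  -- collects the errors of replacing `A` by 0 at even and by P at odd indices.
  have e : (2 : 𝕜) • ∑ k ∈ Finset.range L, T (n (2 * k + 1)) * (1 - P) =
      (∑ i ∈ Finset.range (2 * L), T (n i) * (1 - 2 * A i)) + altSum T n (2 * L) +
        (2 : 𝕜) • ∑ k ∈ Finset.range L,
          (T (n (2 * k)) * A (2 * k) + T (n (2 * k + 1)) * (A (2 * k + 1) - P)) := by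
    have hsum : ∀ (f : ℕ → X →L[𝕜] X) (L : ℕ), ∑ i ∈ Finset.range (2 * L), f i =
        ∑ k ∈ Finset.range L, (f (2 * k) + f (2 * k + 1)) := by
      intro f L
      induction L with
      | zero => simp
      | succ L ih =>
        rw [show 2 * (L + 1) = 2 * L + 1 + 1 by ring, Finset.sum_range_succ,
          Finset.sum_range_succ, ih, Finset.sum_range_succ, add_assoc]
    rw [hsum, altSum_two_mul, Finset.smul_sum, Finset.smul_sum, ← Finset.sum_add_distrib,
      ← Finset.sum_add_distrib]
    refine Finset.sum_congr rfl fun k _ => ?_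
    rw [two_smul, two_smul]
    noncomm_ring
  set d : ℝ := 3 / 2 / L' with hd
  have h3 : ‖∑ k ∈ Finset.range L,
      (T (n (2 * k)) * A (2 * k) + T (n (2 * k + 1)) * (A (2 * k + 1) - P))‖ ≤
      L * (3 / 2 * (2 * L * d) + 3 / 2 * (2 * L * d)) := by
    refine (norm_sum_le_of_le (f := fun k => T (n (2 * k)) * A (2 * k) +
      T (n (2 * k + 1)) * (A (2 * k + 1) - P))
      (n := fun _ => 3 / 2 * (2 * L * d) + 3 / 2 * (2 * L * d)) _ fun k hk => ?_).trans_eq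
      (by simp [mul_add])
    have hk := Finset.mem_range.1 hk
    obtain ⟨h4, h5⟩ := h.norm_average_altSum_le (q := q) (s := s) (L := L') k (by omega)
    have hkL : (2 * k + 1 : ℝ) ≤ 2 * L := by exact_mod_cast (by omega : 2 * k + 1 ≤ 2 * L)
    have hd0 : 0 ≤ d := by positivity
    refine (norm_add_le _ _).trans (add_le_add ?_ ?_)
    · refine (norm_mul_le _ _).trans (mul_le_mul (h.norm_le _) (h4.trans ?_) (norm_nonneg _)
        (by norm_num))
      gcongr
    · refine (norm_mul_le _ _).trans (mul_le_mul (h.norm_le _) (h5.trans ?_) (norm_nonneg _)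
        (by norm_num))
      gcongr
  have hLd : L * (3 / 2 * (2 * L * d) + 3 / 2 * (2 * L * d)) ≤ 9 := by
    have hLr : (L : ℝ) ^ 2 ≤ L' := by exact_mod_cast hLL
    have : L * (3 / 2 * (2 * L * d) + 3 / 2 * (2 * L * d)) = 9 * (L ^ 2 / L') := by
      rw [hd]
      ring
    rw [this]
    have : (L : ℝ) ^ 2 / L' ≤ 1 := div_le_one_of_le₀ hLr (by positivity)
    linarith
  have h6 : ‖(2 : 𝕜) • ∑ k ∈ Finset.range L, T (n (2 * k + 1)) * (1 - P)‖ ≤ 3 + 3 / 2 + 2 * 9 := by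
    rw [e]
    refine norm_add₃_le.trans (add_le_add (add_le_add h1 h2) ?_)
    rw [norm_smul, RCLike.norm_two]
    linarith
  rw [norm_smul, RCLike.norm_two] at h6
  have e2 : progAverage T (B + t) (2 * t) L * (1 - P) =
      (L : 𝕜)⁻¹ • ∑ k ∈ Finset.range L, T (n (2 * k + 1)) * (1 - P) := by
    rw [progAverage, average, smul_mul_assoc, Finset.sum_mul]
    congr 1
    refine Finset.sum_congr rfl fun k _ => ?_
    rw [show B + t + 2 * t * k = n (2 * k + 1) by simp only [n]; ring]
  rw [e2, norm_smul, norm_inv, RCLike.norm_natCast, div_eq_inv_mul]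
  gcongr
  linarith

end IsReflectionChain

end Averages

/-! ### Commuting sequences from the metric unconditional approximation property -/

section Metric

variable {𝕜 : Type*} [RCLike 𝕜] {X : Type*} [NormedAddCommGroup X] [NormedSpace 𝕜 X]

/-- The operator εT_k + (1 - T_k) is the strong limit of the signed sums with sign ε up to k and
sign 1 afterwards. -/
theorem UncondBound.norm_one_add_smul_le {S : Set 𝕜} (hS : IsSignSet S) {T : ℕ → X →L[𝕜] X}
    {C : ℝ} (hC : UncondBound S T C) (hT : IsApproxSeq T) (k : ℕ) {ε : 𝕜} (hε : ε ∈ S) :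
    ‖1 + (ε - 1) • T k‖ ≤ C := by
  have hC0 : 0 ≤ C := (norm_nonneg _).trans (hC.norm_le hS hT.zero 0)
  refine ContinuousLinearMap.opNorm_le_bound _ hC0 fun x => ?_
  have hlim : Tendsto (fun l => ε • T k x + (T l x - T k x)) atTop
      (𝓝 (ε • T k x + (x - T k x))) :=
    ((hT.tendsto x).sub_const _).const_add _
  have e : (1 + (ε - 1) • T k) x = ε • T k x + (x - T k x) := by
    change x + (ε - 1) • T k x = _
    rw [sub_smul, one_smul]
    abel
  rw [e]
  refine le_of_tendsto hlim.norm ?_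
  filter_upwards [eventually_ge_atTop k] with l hl
  have h := hC l (fun i => if i < k then ε else 1) fun i => by
    split_ifs
    exacts [hε, hS.one_mem]
  have e2 : ∑ i ∈ Finset.range l, (if i < k then ε else 1) • (T (i + 1) - T i) =
      ε • T k + (T l - T k) := by
    rw [← Finset.sum_range_add_sum_Ico _ hl, ← Finset.sum_Ico_sub (fun i => T i) hl]
    congr 1
    · have : T k = ∑ i ∈ Finset.range k, (T (i + 1) - T i) := by
        rw [Finset.sum_range_sub, hT.zero, sub_zero]
      conv_rhs => rw [this, Finset.smul_sum]
      refine Finset.sum_congr rfl fun i hi => ?_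
      rw [if_pos (Finset.mem_range.1 hi)]
    · refine Finset.sum_congr rfl fun i hi => ?_
      rw [if_neg (not_lt.2 (Finset.mem_Ico.1 hi).1), one_smul]
  rw [e2] at h
  exact ContinuousLinearMap.le_of_opNorm_le _ h x

theorem IsSignSet.norm_sub_one_le {S : Set 𝕜} (hS : IsSignSet S) {ε : 𝕜} (hε : ε ∈ S) :
    ‖ε - 1‖ ≤ 2 := by
  refine (norm_sub_le _ _).trans ?_
  rw [hS.norm_eq ε hε, norm_one]
  norm_num

theorem norm_one_add_smul_le_of_near {S : Set 𝕜} (hS : IsSignSet S) {A B : X →L[𝕜] X} {c d : ℝ}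
    {ε : 𝕜} (hε : ε ∈ S) (h : ‖1 + (ε - 1) • A‖ ≤ c) (hd : ‖B - A‖ ≤ d) :
    ‖1 + (ε - 1) • B‖ ≤ c + 2 * d := by
  have e : 1 + (ε - 1) • B = (1 + (ε - 1) • A) + (ε - 1) • (B - A) := by
    rw [smul_sub]
    abel
  rw [e]
  refine (norm_add_le _ _).trans (add_le_add h ?_)
  rw [norm_smul]
  exact mul_le_mul (hS.norm_sub_one_le hε) hd (norm_nonneg _) (by norm_num)

/-- Under the metric unconditional approximation property, there are almost unconditional finite
rank operators that fix a given finite dimensional subspace. -/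
theorem HasUMAP.exists_operator {S : Set 𝕜} (hS : IsSignSet S) (h : HasUMAP S X)
    (F : Submodule 𝕜 X) [FiniteDimensional 𝕜 F] {η : ℝ} (hη : 0 < η) :
    ∃ T : X →L[𝕜] X, FiniteDimensional 𝕜 (LinearMap.range (T : X →ₗ[𝕜] X)) ∧
      (∀ x ∈ F, T x = x) ∧ ∀ ε ∈ S, ‖1 + (ε - 1) • T‖ ≤ 1 + η := by
  obtain ⟨T, hT, hC⟩ := h (η / 2) (by positivity)
  obtain ⟨f, hf⟩ := Submodule.ClosedComplemented.of_finiteDimensional F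
  set P : X →L[𝕜] X := F.subtypeL.comp f with hP
  have hPfin : FiniteDimensional 𝕜 (LinearMap.range (P : X →ₗ[𝕜] X)) := by
    refine Submodule.finiteDimensional_of_le (S₂ := F) ?_
    rintro _ ⟨x, rfl⟩
    exact (f x).2
  have hPx : ∀ x ∈ F, P x = x := fun x hx => congrArg Subtype.val (hf ⟨x, hx⟩)
  have h1 := (tendsto_mul_of_finiteDimensional hT.tendsto P hPfin).norm
  rw [norm_zero] at h1
  obtain ⟨k, hk⟩ := (h1.eventually_le_const (show 0 < η / 4 by positivity)).exists
  -- With P a projection onto `F`, the correction makes the operator exact on `F` and is small in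
  -- norm for large k.
  refine ⟨T k + (1 - T k) * P, finiteDimensional_range_add _ _ (hT.finite_rank k)
    (finiteDimensional_range_mul_left _ _ hPfin), fun x hx => ?_, fun ε hε => ?_⟩
  · change T k x + (P x - T k (P x)) = x
    rw [hPx x hx]
    abel
  · have := norm_one_add_smul_le_of_near hS hε (hC.norm_one_add_smul_le hS hT k hε)
      (B := T k + (1 - T k) * P) (d := η / 4) (by rwa [add_sub_cancel_left])
    linarith

theorem one_add_neg_two_smul (A : X →L[𝕜] X) : 1 + ((-1 : 𝕜) - 1) • A = 1 - 2 * A := by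
  rw [sub_smul, neg_smul, one_smul, two_mul]
  abel

theorem norm_le_of_norm_one_add_smul_le {S : Set 𝕜} (hS : IsSignSet S) {A : X →L[𝕜] X} {c : ℝ}
    (h : ∀ ε ∈ S, ‖1 + (ε - 1) • A‖ ≤ c) : ‖A‖ ≤ (1 + c) / 2 := by
  have := h (-1) hS.neg_one_mem
  rw [one_add_neg_two_smul] at this
  exact norm_le_of_one_sub_two_mul this

/-- Each operator is chosen to fix a finite dimensional space containing the earlier ranges and the
first points of a dense sequence. Fixing ranges gives the chain relation, fixing the points gives
strong convergence. -/
theorem HasUMAP.exists_chain [TopologicalSpace.SeparableSpace X] {S : Set 𝕜} (hS : IsSignSet S)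
    (h : HasUMAP S X) :
    ∃ T : ℕ → X →L[𝕜] X, IsReflectionChain T (fun k => 1 / 4 * (1 / 2) ^ k) ∧
      (∀ k, FiniteDimensional 𝕜 (LinearMap.range (T k : X →ₗ[𝕜] X))) ∧
      (∀ x, Tendsto (fun k => T k x) atTop (𝓝 x)) ∧
      ∀ k, ∀ ε ∈ S, ‖1 + (ε - 1) • T k‖ ≤ 1 + 1 / 4 * (1 / 2) ^ k := by
  let d := TopologicalSpace.denseSeq X
  obtain ⟨f, -, hf⟩ := exists_seq_of_step
    (fun a : (X →L[𝕜] X) × Submodule 𝕜 X => FiniteDimensional 𝕜 a.2 ∧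
      FiniteDimensional 𝕜 (LinearMap.range (a.1 : X →ₗ[𝕜] X)) ∧
      LinearMap.range (a.1 : X →ₗ[𝕜] X) ≤ a.2)
    (fun k a b => a.2 ≤ b.2 ∧ d k ∈ b.2 ∧ (∀ x ∈ a.2, b.1 x = x) ∧
      ∀ ε ∈ S, ‖1 + (ε - 1) • b.1‖ ≤ 1 + 1 / 4 * (1 / 2) ^ k)
    (0, ⊥) ⟨inferInstance, finiteDimensional_range_zero, by
      rintro _ ⟨x, rfl⟩
      simp⟩ (by
      rintro k ⟨R, F⟩ ⟨hF, hR, hRF⟩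
      obtain ⟨T, hT, hTF, hTS⟩ := h.exists_operator hS F
        (show (0 : ℝ) < 1 / 4 * (1 / 2) ^ k by positivity)
      refine ⟨(T, F ⊔ (LinearMap.range (T : X →ₗ[𝕜] X) ⊔ Submodule.span 𝕜 {d k})),
        ⟨?_, hT, le_sup_left.trans le_sup_right⟩, le_sup_left, ?_, hTF, hTS⟩
      · dsimp only at hF ⊢
        infer_instance
      · exact Submodule.mem_sup_right (Submodule.mem_sup_right
          (Submodule.mem_span_singleton_self _)))
  have hmono : Monotone fun k => (f k).2 := monotone_nat_of_le_succ fun k => (hf k).2.1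
  have hfix : ∀ n k, n ≤ k → ∀ x ∈ (f n).2, (f (k + 1)).1 x = x := fun n k hnk x hx =>
    (hf k).2.2.2.1 x (hmono hnk hx)
  have hchain : IsReflectionChain (fun k => (f (k + 1)).1) (fun k => 1 / 4 * (1 / 2) ^ k) := by
    refine ⟨fun n m hnm => ?_, fun k => by positivity, fun k => ?_, fun s => ?_⟩
    · ext x
      exact hfix (n + 1) m hnm _ ((hf (n + 1)).1.2.2 ⟨x, rfl⟩)
    · rw [← one_add_neg_two_smul]
      exact (hf k).2.2.2.2 _ hS.neg_one_mem
    · refine (prod_one_add_le_exp _ (fun k => by positivity)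
        (sum_geometric_le (1 / 4) (by norm_num)) s).trans ?_
      rw [← Real.le_log_iff_exp_le (by norm_num)]
      have := Real.log_two_gt_d9
      linarith
  refine ⟨fun k => (f (k + 1)).1, hchain, fun k => (hf (k + 1)).1.2.1, ?_,
    fun k => (hf k).2.2.2.2⟩
  refine tendsto_of_dense hchain.norm_le (TopologicalSpace.denseRange_denseSeq X) ?_
  rintro _ ⟨j, rfl⟩
  refine tendsto_const_nhds.congr' ?_
  filter_upwards [eventually_ge_atTop (j + 1)] with k hk
  exact (hfix (j + 1) k hk _ (hf j).2.2.1).symm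

/-- The product `Q i * Q (i + 1) * ⋯ * Q (i + n)`. -/
def tailProd (Q : ℕ → X →L[𝕜] X) : ℕ → ℕ → X →L[𝕜] X
  | 0, i => Q i
  | n + 1, i => Q i * tailProd Q n (i + 1)

/-- A sequence with rapidly decreasing `Q i - Q i * Q (i + 1)` has a small perturbation `M` with
`M i * M j → M i` in norm. -/
theorem exists_perturbation_of_mul_succ [CompleteSpace X] {Q : ℕ → X →L[𝕜] X} {c : ℝ}
    (hQ : ∀ i, ‖Q i‖ ≤ 2) (hc : ∀ i, ‖Q i * (1 - Q (i + 1))‖ ≤ c * (1 / 4) ^ i) :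
    ∃ M : ℕ → X →L[𝕜] X, (∀ i, M i = Q i * M (i + 1)) ∧
      (∀ i, ‖M i - Q i‖ ≤ 2 * c * (1 / 4) ^ i) ∧
      ∀ i, Tendsto (fun j => M i * (1 - M j)) atTop (𝓝 0) := by
  have hc0 : 0 ≤ c := by simpa using (norm_nonneg _).trans (hc 0)
  -- The factor 2 from `‖Q i‖` is beaten by the gain 1/4 from shifting i; the constant 2c reproduces
  -- itself because 2 · 2c/4 + c = 2c.
  have h1 : ∀ n i, ‖tailProd Q n i - Q i‖ ≤ 2 * c * (1 / 4) ^ i := by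
    intro n
    induction n with
    | zero =>
      intro i
      simp only [tailProd, sub_self, norm_zero]
      positivity
    | succ n ih =>
      intro i
      have e : tailProd Q (n + 1) i - Q i =
          Q i * (tailProd Q n (i + 1) - Q (i + 1)) - Q i * (1 - Q (i + 1)) := by
        rw [tailProd]
        noncomm_ring
      rw [e]
      refine (norm_sub_le _ _).trans ((add_le_add ((norm_mul_le _ _).trans
        (mul_le_mul (hQ i) (ih (i + 1)) (norm_nonneg _) (by norm_num))) (hc i)).trans_eq ?_)
      rw [pow_succ]
      ring
  have h2 : ∀ n i, ‖tailProd Q n i - tailProd Q (n + 1) i‖ ≤ c * (1 / 4) ^ i * (1 / 2) ^ n := by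
    intro n
    induction n with
    | zero =>
      intro i
      have : tailProd Q 0 i - tailProd Q (0 + 1) i = Q i * (1 - Q (i + 1)) := by
        simp only [tailProd]
        noncomm_ring
      rw [this]
      simpa using hc i
    | succ n ih =>
      intro i
      have e : tailProd Q (n + 1) i - tailProd Q (n + 1 + 1) i =
          Q i * (tailProd Q n (i + 1) - tailProd Q (n + 1) (i + 1)) := by
        rw [mul_sub]
        rfl
      rw [e]
      refine ((norm_mul_le _ _).trans
        (mul_le_mul (hQ i) (ih (i + 1)) (norm_nonneg _) (by norm_num))).trans_eq ?_
      rw [pow_succ, pow_succ]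
      ring
  have h3 : ∀ i, ∃ M, Tendsto (fun n => tailProd Q n i) atTop (𝓝 M) := fun i =>
    cauchySeq_tendsto_of_complete (cauchySeq_of_le_geometric (1 / 2) (c * (1 / 4) ^ i)
      (by norm_num) fun n => by rw [dist_eq_norm]; exact h2 n i)
  choose M hM using h3
  have hMQ : ∀ i, M i = Q i * M (i + 1) := fun i =>
    tendsto_nhds_unique ((hM i).comp (tendsto_add_atTop_nat 1)) ((hM (i + 1)).const_mul (Q i))
  have hMd : ∀ i, ‖M i - Q i‖ ≤ 2 * c * (1 / 4) ^ i := fun i =>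
    le_of_tendsto ((hM i).sub_const _).norm (Eventually.of_forall fun n => h1 n i)
  refine ⟨M, hMQ, hMd, ?_⟩
  have hp : ∀ i : ℕ, (1 / 4 : ℝ) ^ i ≤ 1 := fun i => pow_le_one₀ (by norm_num) (by norm_num)
  have hMn : ∀ i, ‖1 - M i‖ ≤ 3 + 2 * c := by
    intro i
    have e : 1 - M i = 1 - Q i - (M i - Q i) := by abel
    rw [e]
    have h4 : ‖1 - Q i‖ ≤ 1 + 2 :=
      (norm_sub_le _ _).trans (add_le_add ContinuousLinearMap.norm_id_le (hQ i))
    have h5 : ‖M i - Q i‖ ≤ 2 * c :=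
      (hMd i).trans (mul_le_of_le_one_right (by positivity) (hp i))
    have h6 := norm_sub_le (1 - Q i) (M i - Q i)
    linarith
  set K : ℝ := 2 * c * (3 + 2 * c) + 2 * c with hK
  have h4 : ∀ n i, ‖M i * (1 - M (i + n + 1))‖ ≤ K * (1 / 4) ^ i * (1 / 2) ^ n := by
    intro n
    induction n with
    | zero =>
      intro i
      -- The relation `M i = Q i * M (i + 1)` turns `Q i * (1 - M (i + 1))` into `Q i - M i`, which
      -- is already small.
      have e : M i * (1 - M (i + 0 + 1)) = (M i - Q i) * (1 - M (i + 1)) - (M i - Q i) := by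
        have := hMQ i
        calc M i * (1 - M (i + 1)) = (M i - Q i) * (1 - M (i + 1)) + Q i - Q i * M (i + 1) := by
              noncomm_ring
          _ = _ := by rw [← this]; abel
      rw [e]
      refine (norm_sub_le _ _).trans ((add_le_add ((norm_mul_le _ _).trans
        (mul_le_mul (hMd i) (hMn _) (norm_nonneg _) (by positivity))) (hMd i)).trans_eq ?_)
      rw [hK]
      ring
    | succ n ih =>
      intro i
      have e : M i * (1 - M (i + (n + 1) + 1)) = Q i * (M (i + 1) * (1 - M (i + 1 + n + 1))) := by
        rw [← mul_assoc, ← hMQ, show i + (n + 1) + 1 = i + 1 + n + 1 by ring]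
      rw [e]
      refine ((norm_mul_le _ _).trans
        (mul_le_mul (hQ i) (ih (i + 1)) (norm_nonneg _) (by norm_num))).trans_eq ?_
      rw [pow_succ, pow_succ]
      ring
  intro i
  rw [← tendsto_add_atTop_iff_nat (i + 1)]
  refine squeeze_zero_norm (a := fun n => K * (1 / 4) ^ i * (1 / 2) ^ n) (fun n => ?_) ?_
  · have := h4 n i
    rwa [show i + n + 1 = n + (i + 1) by ring] at this
  · simpa using (tendsto_pow_atTop_nhds_zero_of_lt_one (r := (1 / 2 : ℝ)) (by norm_num)
      (by norm_num)).const_mul (K * (1 / 4) ^ i)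

/-- The metric unconditional approximation property yields an almost commuting approximating
sequence that is asymptotically unconditional. -/
theorem HasUMAP.exists_almost_commuting [CompleteSpace X] [TopologicalSpace.SeparableSpace X]
    {S : Set 𝕜} (hS : IsSignSet S) (h : HasUMAP S X) :
    ∃ M : ℕ → X →L[𝕜] X, (∀ k, FiniteDimensional 𝕜 (LinearMap.range (M k : X →ₗ[𝕜] X))) ∧
      (∀ x, Tendsto (fun k => M k x) atTop (𝓝 x)) ∧
      (∀ i, Tendsto (fun j => M i * (1 - M j)) atTop (𝓝 0)) ∧
      ∀ κ : ℝ, 0 < κ → ∀ᶠ k in atTop, ∀ ε ∈ S, ‖1 + (ε - 1) • M k‖ ≤ 1 + κ := by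
  obtain ⟨T, hT, hfin, hlim, hTS⟩ := h.exists_chain hS
  -- This makes L(i + 1) = L(i)², as the averaging estimate requires, with errors 12/L(i) at most
  -- 12/4^i, fast enough against factors of norm 2.
  let L : ℕ → ℕ := fun i => 4 ^ 2 ^ i
  have hL : ∀ i, 4 ^ i ≤ L i := fun i =>
    Nat.pow_le_pow_right (by norm_num) Nat.lt_two_pow_self.le
  have hL0 : ∀ i, 0 < L i := fun i => by positivity
  have hiL : ∀ i, i ≤ L i := fun i => (Nat.lt_pow_self (by norm_num)).le.trans (hL i)
  have hL4 : ∀ i, 4 ≤ L i := fun i => by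
    calc 4 = 4 ^ 1 := rfl
      _ ≤ L i := Nat.pow_le_pow_right (by norm_num) Nat.one_le_two_pow
  have hLs : ∀ i, L (i + 1) = L i ^ 2 := fun i => by
    simp only [L]
    rw [← pow_mul, pow_succ]
  -- The averaging estimate is used with B = 2L² and t = L; the next progression starts beyond all
  -- indices B + t i, i < 2L.
  let Q : ℕ → X →L[𝕜] X := fun i => progAverage T (2 * L i ^ 2 + L i) (2 * L i) (L i)
  have hQn : ∀ i, ‖Q i‖ ≤ 2 := fun i => (hT.norm_progAverage_le _ _ _).trans (by norm_num)
  have hQQ : ∀ i, ‖Q i * (1 - Q (i + 1))‖ ≤ 12 * (1 / 4) ^ i := by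
    intro i
    refine (hT.norm_progAverage_mul_one_sub_le (hL0 i) (hL0 i) (hLs i).ge ?_ ?_).trans ?_
    · rw [hLs]
      nlinarith [hL4 i]
    · rw [hLs]
      have h1 : 16 ≤ L i ^ 2 := by nlinarith [hL4 i]
      nlinarith
    · rw [div_eq_mul_inv, one_div, inv_pow]
      gcongr
      exact_mod_cast hL i
  obtain ⟨M, hMQ, hMd, hMM⟩ := exists_perturbation_of_mul_succ hQn hQQ
  have hd0 : Tendsto (fun i : ℕ => 2 * 12 * (1 / 4 : ℝ) ^ i) atTop (𝓝 0) := by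
    simpa using (tendsto_pow_atTop_nhds_zero_of_lt_one (r := (1 / 4 : ℝ)) (by norm_num)
      (by norm_num)).const_mul (2 * 12)
  have hle : ∀ i l, i ≤ 2 * L i ^ 2 + L i + 2 * L i * l := fun i l => by
    have := hiL i
    have h2 := Nat.zero_le (2 * L i ^ 2)
    have h3 := Nat.zero_le (2 * L i * l)
    omega
  have hQlim : ∀ x, Tendsto (fun i => Q i x) atTop (𝓝 x) := by
    intro x
    rw [Metric.tendsto_atTop]
    intro ε hε
    obtain ⟨N, hN⟩ := Metric.tendsto_atTop.1 (hlim x) (ε / 2) (by positivity)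
    refine ⟨N, fun i hi => ?_⟩
    have e : Q i x - x =
        average (𝕜 := 𝕜) (fun l => T (2 * L i ^ 2 + L i + 2 * L i * l) x - x) (L i) := by
      rw [average_sub, average_const _ (hL0 i)]
      simp [Q, progAverage, average]
    rw [dist_eq_norm, e]
    refine (norm_average_le (c := ε / 2) (by positivity) fun l _ => ?_).trans_lt (by linarith)
    have := hN _ (hi.le.trans (hle i l))
    rw [dist_eq_norm] at this
    exact this.le
  refine ⟨M, fun k => ?_, fun x => ?_, hMM, fun κ hκ => ?_⟩
  · rw [hMQ]
    refine finiteDimensional_range_mul_right _ _ ?_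
    have e : Q k = ∑ l ∈ Finset.range (L k),
        (L k : 𝕜)⁻¹ • T (2 * L k ^ 2 + L k + 2 * L k * l) := by
      rw [← Finset.smul_sum]
      rfl
    rw [e]
    exact finiteDimensional_range_sum _ _ _ fun l => hfin _
  · have h2 : Tendsto (fun k => (M k - Q k) x) atTop (𝓝 0) := by
      refine squeeze_zero_norm (a := fun k => 2 * 12 * (1 / 4) ^ k * ‖x‖) (fun k => ?_) ?_
      · exact ContinuousLinearMap.le_of_opNorm_le _ (hMd k) x
      · simpa using hd0.mul_const ‖x‖
    have h3 := (hQlim x).add h2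
    rw [add_zero] at h3
    refine h3.congr fun k => ?_
    simp
  · have h1 : Tendsto (fun i : ℕ => 1 / 4 * (1 / 2 : ℝ) ^ i) atTop (𝓝 0) := by
      simpa only [mul_zero] using (tendsto_pow_atTop_nhds_zero_of_lt_one (r := (1 / 2 : ℝ))
        (by norm_num) (by norm_num)).const_mul (1 / 4)
    filter_upwards [hd0.eventually_le_const (show 0 < κ / 4 by positivity),
      h1.eventually_le_const (show 0 < κ / 2 by positivity)] with i hi1 hi2 ε hε
    have hQS : ‖1 + (ε - 1) • Q i‖ ≤ 1 + κ / 2 := by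
      have e : 1 + (ε - 1) • Q i = average (𝕜 := 𝕜)
          (fun l => 1 + (ε - 1) • T (2 * L i ^ 2 + L i + 2 * L i * l)) (L i) := by
        rw [average_add, average_const _ (hL0 i)]
        simp only [Q, progAverage, average]
        rw [← Finset.smul_sum, smul_comm]
      rw [e]
      refine norm_average_le (by positivity) fun l _ => (hTS _ ε hε).trans ?_
      have : (1 / 2 : ℝ) ^ (2 * L i ^ 2 + L i + 2 * L i * l) ≤ (1 / 2) ^ i :=
        pow_le_pow_of_le_one (by norm_num) (by norm_num) (hle i l)
      linarith
    have := norm_one_add_smul_le_of_near hS hε hQS ((hMd i).trans hi1)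
    linarith

/-- Asymptotically unconditional sequences with `R k * R l = R l * R k = R (min k l)` for `k ≠ l`
are unconditional. -/
theorem uncondBound_of_mul {S : Set 𝕜} (hS : IsSignSet S) {R : ℕ → X →L[𝕜] X} (h0 : R 0 = 0)
    (hR : ∀ k l, k < l → R k * R l = R k ∧ R l * R k = R k) {c : ℝ} (hc : 0 ≤ c)
    (h : ∀ k, ∀ ε ∈ S, ‖1 + (ε - 1) • R (k + 1)‖ ≤ 1 + c * (1 / 2) ^ k) :
    UncondBound S R (Real.exp (2 * c) + (1 + (2 + c) / 2)) := by
  intro n θ hθ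
  have hRn : ∀ k, ‖R k‖ ≤ (2 + c) / 2 := by
    intro k
    cases k with
    | zero =>
      rw [h0, norm_zero]
      positivity
    | succ k =>
      refine (norm_le_of_norm_one_add_smul_le hS (h k)).trans ?_
      have : c * (1 / 2 : ℝ) ^ k ≤ c :=
        mul_le_of_le_one_right hc (pow_le_one₀ (by norm_num) (by norm_num))
      linarith
  -- With the tail added, the signed sum is multiplicative: passing from n to n + 1 multiplies it on
  -- the right by an operator that changes the sign of the tail `1 - R (n + 1)` alone.
  have key : ∀ n, ‖∑ k ∈ Finset.range n, θ k • (R (k + 1) - R k) + θ n • (1 - R n)‖ ≤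
      ∏ k ∈ Finset.range n, (1 + c * (1 / 2) ^ k) := by
    intro n
    induction n with
    | zero =>
      rw [Finset.sum_range_zero, zero_add, h0, sub_zero, norm_smul, hS.norm_eq _ (hθ 0), one_mul,
        Finset.prod_range_zero]
      exact ContinuousLinearMap.norm_id_le
    | succ n ih =>
      set W := ∑ k ∈ Finset.range n, θ k • (R (k + 1) - R k) with hW
      set ε := θ (n + 1) * (θ n)⁻¹ with hε
      have hθn := hS.ne_zero (hθ n)
      have hεS : ε ∈ S := hS.mul_mem _ (hθ _) _ (hS.inv_mem _ (hθ n))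
      have hWR : W * (1 - R (n + 1)) = 0 := by
        rw [hW, Finset.sum_mul]
        refine Finset.sum_eq_zero fun k hk => ?_
        have hk := Finset.mem_range.1 hk
        rw [smul_mul_assoc, mul_sub, mul_one, sub_mul, (hR (k + 1) (n + 1) (by omega)).1,
          (hR k (n + 1) (by omega)).1, sub_self, smul_zero]
      have hRR : (1 - R n) * (1 - R (n + 1)) = 1 - R (n + 1) := by
        rw [mul_sub, mul_one, sub_mul, (hR n (n + 1) (by omega)).1, one_mul]
        abel
      have e : ∑ k ∈ Finset.range (n + 1), θ k • (R (k + 1) - R k) + θ (n + 1) • (1 - R (n + 1)) =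
          (W + θ n • (1 - R n)) * (1 + (ε - 1) • (1 - R (n + 1))) := by
        have e1 : (W + θ n • (1 - R n)) * (1 - R (n + 1)) = θ n • (1 - R (n + 1)) := by
          rw [add_mul, hWR, zero_add, smul_mul_assoc, hRR]
        have e2 : (ε - 1) * θ n = θ (n + 1) - θ n := by
          rw [hε, sub_mul, inv_mul_cancel_right₀ hθn, one_mul]
        rw [mul_add, mul_one, mul_smul_comm, e1, smul_smul, e2, Finset.sum_range_succ, ← hW,
          sub_smul]
        simp only [smul_sub]
        abel
      have hn : ‖1 + (ε - 1) • (1 - R (n + 1))‖ ≤ 1 + c * (1 / 2) ^ n := by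
        have e3 : 1 + (ε - 1) • (1 - R (n + 1)) = ε • (1 + (ε⁻¹ - 1) • R (n + 1)) := by
          rw [smul_add, smul_smul, mul_sub, mul_inv_cancel₀ (hS.ne_zero hεS), mul_one, smul_sub,
            sub_smul, sub_smul, sub_smul]
          simp only [one_smul]
          abel
        rw [e3, norm_smul, hS.norm_eq _ hεS, one_mul]
        exact h n _ (hS.inv_mem _ hεS)
      rw [e, Finset.prod_range_succ]
      exact (norm_mul_le _ _).trans (mul_le_mul ih hn (norm_nonneg _)
        (Finset.prod_nonneg fun k _ => by positivity))
  have e : ∑ k ∈ Finset.range n, θ k • (R (k + 1) - R k) =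
      ∑ k ∈ Finset.range n, θ k • (R (k + 1) - R k) + θ n • (1 - R n) - θ n • (1 - R n) := by
    abel
  rw [e]
  refine (norm_sub_le _ _).trans (add_le_add ((key n).trans
    (prod_one_add_le_exp _ (fun k => by positivity) (sum_geometric_le c hc) _)) ?_)
  rw [norm_smul, hS.norm_eq _ (hθ n), one_mul]
  exact (norm_sub_le _ _).trans (add_le_add ContinuousLinearMap.norm_id_le (hRn n))

/-- For n < k, `R k` fixes the range of `R n` and kills that of `1 - R (k + 1)`. So 1 + (ab⁻¹ -
1)R_k, of norm nearly 1, maps bu + v to au + v. -/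
theorem blockUncond_of_mul {S : Set 𝕜} (hS : IsSignSet S) {R : ℕ → X →L[𝕜] X} {C : ℝ}
    (hC : ∀ k, ‖R k‖ ≤ C) (hR : ∀ k l, k < l → R k * R l = R k ∧ R l * R k = R k)
    (h : ∀ κ : ℝ, 0 < κ → ∀ᶠ k in atTop, ∀ ε ∈ S, ‖1 + (ε - 1) • R k‖ ≤ 1 + κ) :
    BlockUncond S R := by
  intro ε hε n _
  have hC0 : 0 ≤ C := (norm_nonneg _).trans (hC 0)
  obtain ⟨k, hk, hnk⟩ := ((h (ε / (1 + 2 * C)) (by positivity)).and (eventually_gt_atTop n)).exists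
  refine ⟨k + 1, by omega, ?_⟩
  rintro _ ⟨x, hx, rfl⟩ _ ⟨y, hy, rfl⟩
  rw [mem_closedBall_zero_iff] at hx hy
  rw [signOsc_norm_le_iff hS]
  intro a ha b hb
  set u := R n x with hu
  set v := (ContinuousLinearMap.id 𝕜 X - R (k + 1)) y with hv
  have hRu : R k u = u := DFunLike.congr_fun (hR n k hnk).2 x
  have hRv : R k v = 0 := by
    have : R k (R (k + 1) y) = R k y := DFunLike.congr_fun (hR k (k + 1) (by omega)).1 y
    rw [hv, sub_apply, map_sub, this]
    simp
  have hb0 := hS.ne_zero hb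
  have e : a • u + v = (1 + (a * b⁻¹ - 1) • R k) (b • u + v) := by
    change a • u + v = b • u + v + (a * b⁻¹ - 1) • R k (b • u + v)
    rw [map_add, map_smul, hRu, hRv, add_zero, smul_smul, sub_mul, inv_mul_cancel_right₀ hb0,
      one_mul, sub_smul]
    abel
  have hbound : ‖b • u + v‖ ≤ 1 + 2 * C := by
    refine (norm_add_le _ _).trans ?_
    rw [hS.norm_smul hb]
    have h1 : ‖u‖ ≤ C := by simpa using (R n).le_of_opNorm_le_of_le (hC n) hx
    have h2 : ‖v‖ ≤ 1 + C := by
      have h3 := (R (k + 1)).le_of_opNorm_le_of_le (hC (k + 1)) hy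
      rw [mul_one] at h3
      exact (norm_sub_le _ _).trans (add_le_add hy h3)
    linarith
  have h1 := ContinuousLinearMap.le_of_opNorm_le _
    (hk _ (hS.mul_mem _ ha _ (hS.inv_mem _ hb))) (b • u + v)
  rw [← e] at h1
  refine h1.trans ?_
  rw [add_mul, one_mul]
  gcongr
  rw [div_mul_eq_mul_div, div_le_iff₀ (by positivity)]
  gcongr

theorem HasUMAP.exists_blockUncond [CompleteSpace X] [TopologicalSpace.SeparableSpace X]
    {S : Set 𝕜} (hS : IsSignSet S) (h : HasUMAP S X) :
    ∃ T : ℕ → X →L[𝕜] X, IsUncondApproxSeq S T ∧ IsCommutingSeq T ∧ BlockUncond S T := by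
  obtain ⟨M, hfin, hlim, hcom, hM⟩ := h.exists_almost_commuting hS
  have hδ0 : Tendsto (fun k : ℕ => (1 / 2 : ℝ) ^ k) atTop (𝓝 0) :=
    tendsto_pow_atTop_nhds_zero_of_lt_one (by norm_num) (by norm_num)
  obtain ⟨n, R, -, -, hRa, hR, hRM, hp⟩ := exists_commuting_perturbation hfin hlim hcom
    (δ := fun k => (1 / 2) ^ k) (fun k => by positivity) hδ0
    (fun k _ m => ∀ ε ∈ S, ‖1 + (ε - 1) • M m‖ ≤ 1 + (1 / 2) ^ k)
    (fun k _ _ => hM _ (by positivity))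
  have hRS : ∀ k, ∀ ε ∈ S, ‖1 + (ε - 1) • R (k + 1)‖ ≤ 1 + 3 * (1 / 2) ^ k := by
    intro k ε hε
    have := norm_one_add_smul_le_of_near hS hε (hp k ε hε) (hRM k)
    linarith
  have hC := uncondBound_of_mul hS hRa.zero hR (by norm_num) hRS
  refine ⟨R, ⟨hRa, _, hC⟩, isCommutingSeq_of_mul hR,
    blockUncond_of_mul hS (hC.norm_le hS hRa.zero) hR fun κ hκ => ?_⟩
  have h1 : Tendsto (fun k : ℕ => 3 * (1 / 2 : ℝ) ^ k) atTop (𝓝 0) := by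
    simpa using hδ0.const_mul 3
  obtain ⟨N, hN⟩ := eventually_atTop.1 (h1.eventually_le_const hκ)
  filter_upwards [eventually_ge_atTop (N + 1)] with k hk ε hε
  obtain ⟨j, rfl⟩ : ∃ j, k = j + 1 := ⟨k - 1, by omega⟩
  have := hN j (by omega)
  exact (hRS j ε hε).trans (by linarith)

end Metric

/-! ### Finite cotype and averages of skipped blocks -/

section Cotype

variable {𝕜 : Type*} [RCLike 𝕜] {X : Type*} [NormedAddCommGroup X] [NormedSpace 𝕜 X]

/-- A cotype inequality bounds the sum of the norms of vectors whose signed sums are bounded. -/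
theorem sum_norm_le_of_cotype {q C : ℝ} (hq : 2 ≤ q) (hC : ∀ (n : ℕ) (x : Fin n → X),
    (∑ i, ‖x i‖ ^ q) ^ (1 / q) ≤
      C * ((∑ θ : Fin n → ℤˣ, ‖∑ i, (θ i : ℤ) • x i‖) / 2 ^ n))
    {N : ℕ} (y : Fin N → X) {B : ℝ}
    (hy : ∀ σ : Fin N → ℤˣ, ‖∑ i, (σ i : ℤ) • y i‖ ≤ B) :
    ∑ i, ‖y i‖ ≤ (N : ℝ) ^ (1 - 1 / q) * (|C| * B) := by
  have hq0 : 0 < q := by linarith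
  have h1 : (∑ θ : Fin N → ℤˣ, ‖∑ i, (θ i : ℤ) • y i‖) / 2 ^ N ≤ B := by
    rw [div_le_iff₀ (by positivity)]
    refine (Finset.sum_le_sum fun θ _ => hy θ).trans_eq ?_
    rw [Finset.sum_const, Finset.card_univ, Fintype.card_fun, Fintype.card_units_int,
      Fintype.card_fin, nsmul_eq_mul]
    push_cast
    ring
  have h2 : (∑ i, ‖y i‖ ^ q) ^ (1 / q) ≤ |C| * B := by
    refine (hC N y).trans ((mul_le_mul_of_nonneg_right (le_abs_self C) (by positivity)).trans ?_)
    gcongr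
  have h3 := Real.rpow_sum_le_const_mul_sum_rpow (Finset.univ : Finset (Fin N)) (fun i => ‖y i‖)
    (by linarith : 1 ≤ q)
  simp only [abs_norm, Finset.card_univ, Fintype.card_fin] at h3
  have h0 : 0 ≤ ∑ i, ‖y i‖ := by positivity
  calc ∑ i, ‖y i‖ = ((∑ i, ‖y i‖) ^ q) ^ (1 / q) := by
        rw [← Real.rpow_mul h0, mul_one_div_cancel hq0.ne', Real.rpow_one]
    _ ≤ ((N : ℝ) ^ (q - 1) * ∑ i, ‖y i‖ ^ q) ^ (1 / q) := by gcongr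
    _ = (N : ℝ) ^ (1 - 1 / q) * (∑ i, ‖y i‖ ^ q) ^ (1 / q) := by
      rw [Real.mul_rpow (by positivity) (by positivity), ← Real.rpow_mul (by positivity)]
      congr 2
      field_simp
    _ ≤ _ := by gcongr

theorem sum_range_mul_eq {E : Type*} [AddCommMonoid E] (f : ℕ → E) (m N : ℕ) :
    ∑ i ∈ Finset.range (m * N), f i = ∑ k ∈ Finset.range m, ∑ r : Fin N, f (k * N + r) := by
  induction m with
  | zero => simp
  | succ m ih =>
    rw [Nat.succ_mul, Finset.sum_range_add, ih, Finset.sum_range_succ,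
      Finset.sum_range (n := N)]

/-- Asymptotic bounds on signed sums bound all signed sums, by averaging over two signs of a
tail. -/
theorem uncondBound_of_asymptotic {S : Set 𝕜} (hS : IsSignSet S) {T : ℕ → X →L[𝕜] X} {c : ℝ}
    (hc : 0 ≤ c) (A : X → ℕ → ℝ) (hA : ∀ x, Tendsto (A x) atTop (𝓝 (c * ‖x‖)))
    (h : ∀ (x : X) (n : ℕ) (θ : ℕ → 𝕜), (∀ k, θ k ∈ S) →
      ‖∑ k ∈ Finset.range n, θ k • (T (k + 1) x - T k x)‖ ≤ A x n) :
    UncondBound S T c := by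
  intro n θ hθ
  refine ContinuousLinearMap.opNorm_le_bound _ hc fun x => ?_
  refine ge_of_tendsto (hA x) ?_
  filter_upwards [eventually_ge_atTop n] with l hl
  have key : ∀ ε : 𝕜, ∑ k ∈ Finset.range l, (if k < n then θ k else ε) • (T (k + 1) x - T k x) =
      (∑ k ∈ Finset.range n, θ k • (T (k + 1) - T k)) x +
        ε • ∑ k ∈ Finset.Ico n l, (T (k + 1) x - T k x) := by
    intro ε
    rw [← Finset.sum_range_add_sum_Ico _ hl, Finset.smul_sum]
    congr 1
    · rw [sum_apply]
      refine Finset.sum_congr rfl fun k hk => ?_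
      rw [if_pos (Finset.mem_range.1 hk)]
      rfl
    · refine Finset.sum_congr rfl fun k hk => ?_
      rw [if_neg (not_lt.2 (Finset.mem_Ico.1 hk).1)]
  have hb : ∀ ε ∈ S, ‖(∑ k ∈ Finset.range n, θ k • (T (k + 1) - T k)) x +
        ε • ∑ k ∈ Finset.Ico n l, (T (k + 1) x - T k x)‖ ≤ A x l := by
    intro ε hε
    rw [← key]
    refine h x l _ fun k => ?_
    split_ifs
    exacts [hθ k, hε]
  have h1 := hb 1 hS.one_mem
  have h2 := hb (-1) hS.neg_one_mem
  set u := (∑ k ∈ Finset.range n, θ k • (T (k + 1) - T k)) x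
  set v := ∑ k ∈ Finset.Ico n l, (T (k + 1) x - T k x)
  have h3 : (2 : 𝕜) • u = (u + (1 : 𝕜) • v) + (u + (-1 : 𝕜) • v) := by
    rw [two_smul, one_smul, neg_smul, one_smul]
    abel
  have h4 : ‖(2 : 𝕜) • u‖ ≤ A x l + A x l := by
    rw [h3]
    exact (norm_add_le _ _).trans (add_le_add h1 h2)
  rw [norm_smul, RCLike.norm_two] at h4
  linarith

/-- The averages of `N` consecutive operators of a sequence. -/
noncomputable def blockAverage (R : ℕ → X →L[𝕜] X) (N : ℕ) : ℕ → X →L[𝕜] X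
  | 0 => 0
  | k + 1 => average (𝕜 := 𝕜) (fun r => R (k * N + r + 1)) N

theorem blockAverage_succ_apply (R : ℕ → X →L[𝕜] X) (N k : ℕ) (x : X) :
    blockAverage R N (k + 1) x = average (𝕜 := 𝕜) (fun r => R (k * N + r + 1) x) N := by
  simp [blockAverage, average]

theorem isApproxSeq_blockAverage {R : ℕ → X →L[𝕜] X} (hR : IsApproxSeq R) {N : ℕ} (hN : 0 < N) :
    IsApproxSeq (blockAverage R N) := by
  refine ⟨rfl, fun k => ?_, fun x => ?_⟩
  · cases k with
    | zero => exact finiteDimensional_range_zero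
    | succ k =>
      have e : blockAverage R N (k + 1) =
          ∑ r ∈ Finset.range N, (N : 𝕜)⁻¹ • R (k * N + r + 1) := by
        rw [← Finset.smul_sum]
        rfl
      rw [e]
      exact finiteDimensional_range_sum _ _ _ fun r => hR.finite_rank _
  · rw [← tendsto_add_atTop_iff_nat 1, Metric.tendsto_atTop]
    intro ε hε
    obtain ⟨M, hM⟩ := Metric.tendsto_atTop.1 (hR.tendsto x) (ε / 2) (by positivity)
    refine ⟨M, fun k hk => ?_⟩
    have e : blockAverage R N (k + 1) x - x =
        average (𝕜 := 𝕜) (fun r => R (k * N + r + 1) x - x) N := by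
      rw [average_sub, average_const _ hN, blockAverage_succ_apply]
    rw [dist_eq_norm, e]
    refine (norm_average_le (c := ε / 2) (by positivity) fun r _ => ?_).trans_lt (by linarith)
    have h1 : k ≤ k * N := Nat.le_mul_of_pos_right k hN
    have := hM (k * N + r + 1) (by omega)
    rw [dist_eq_norm] at this
    exact this.le

/-- Signed sums of differences spread over a residue class. -/
theorem norm_sum_sign_smul_residues_le {S : Set 𝕜} (hS : IsSignSet S) {R : ℕ → X →L[𝕜] X} {K : ℝ}
    (hK : UncondBound S R K) (h0 : R 0 = 0) (N m : ℕ) (x : X) (φ : ℕ → 𝕜) (hφ : ∀ k, φ k ∈ S)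
    (σ : Fin N → ℤˣ) :
    ‖∑ r : Fin N, (σ r : ℤ) • ∑ k ∈ Finset.range m,
      φ k • (R (k * N + r + 1 + 1) x - R (k * N + r + 1) x)‖ ≤ 2 * K * ‖x‖ := by
  have hσ : ∀ r, ((σ r : ℤ) : 𝕜) ∈ S := by
    intro r
    rcases Int.units_eq_one_or (σ r) with h | h <;> rw [h]
    · simpa using hS.one_mem
    · simpa using hS.neg_one_mem
  let τ : ℕ → 𝕜 := fun r => if h : r < N then ((σ ⟨r, h⟩ : ℤ) : 𝕜) else 1
  have hτ : ∀ r, τ r ∈ S := by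
    intro r
    simp only [τ]
    split_ifs
    exacts [hσ _, hS.one_mem]
  let ψ : ℕ → 𝕜 := fun i => τ (i % N) * φ (i / N)
  have hψ : ∀ i, ψ i ∈ S := fun i => hS.mul_mem _ (hτ _) _ (hφ _)
  have e : ∑ r : Fin N, (σ r : ℤ) • ∑ k ∈ Finset.range m,
      φ k • (R (k * N + r + 1 + 1) x - R (k * N + r + 1) x) =
      (∑ i ∈ Finset.range (m * N), ψ i • (R (i + 1 + 1) - R (i + 1))) x := by
    rw [sum_apply]
    have : ∀ i ∈ Finset.range (m * N), (ψ i • (R (i + 1 + 1) - R (i + 1))) x =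
        ψ i • (R (i + 1 + 1) x - R (i + 1) x) := fun _ _ => rfl
    rw [Finset.sum_congr rfl this, sum_range_mul_eq, Finset.sum_comm]
    refine Finset.sum_congr rfl fun r _ => ?_
    rw [Finset.smul_sum]
    refine Finset.sum_congr rfl fun k _ => ?_
    have hN : 0 < N := r.pos
    have h1 : (k * N + r) % N = r := by
      rw [mul_comm, Nat.mul_add_mod, Nat.mod_eq_of_lt r.2]
    have h2 : (k * N + r) / N = k := by
      rw [mul_comm, Nat.mul_add_div hN, Nat.div_eq_of_lt r.2, add_zero]
    simp only [ψ, h1, h2, τ, r.2, dif_pos]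
    rw [← Int.cast_smul_eq_zsmul 𝕜, smul_smul]
  -- The differences start at index 1, so the first difference `R 1 - R 0` is added and then
  -- removed; this accounts for 2K instead of K.
  have h1 := hK (m * N + 1) (fun j => ψ (j - 1)) fun j => hψ _
  rw [Finset.sum_range_succ'] at h1
  simp only [Nat.add_sub_cancel] at h1
  have h2 : ‖ψ (0 - 1) • (R (0 + 1) - R 0)‖ ≤ K := by
    rw [norm_smul, hS.norm_eq _ (hψ _), one_mul, h0, sub_zero]
    exact hK.norm_le hS h0 _
  have h3 : ‖∑ i ∈ Finset.range (m * N), ψ i • (R (i + 1 + 1) - R (i + 1))‖ ≤ 2 * K := by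
    have h4 := norm_sub_le (∑ i ∈ Finset.range (m * N), ψ i • (R (i + 1 + 1) - R (i + 1)) +
      ψ (0 - 1) • (R (0 + 1) - R 0)) (ψ (0 - 1) • (R (0 + 1) - R 0))
    rw [add_sub_cancel_right] at h4
    linarith
  rw [e]
  exact ContinuousLinearMap.le_of_opNorm_le _ h3 x

/-- Signed sums of the differences along one residue class are bounded by skipped blocks and the
omitted differences. -/
theorem norm_sum_residue_le {S : Set 𝕜} {R : ℕ → X →L[𝕜] X} {c : ℝ}
    (hc : 0 ≤ c) (h0 : R 0 = 0)
    (hR : ∀ a b : ℕ → ℕ, (∀ k, a k < b k) → (∀ k, b k < a (k + 1)) →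
      ∀ x : ℕ → X, (∀ k, x k ∈ Set.range (R (b k) - R (a k))) →
      ∀ (n : ℕ) (θ : ℕ → 𝕜), (∀ k, θ k ∈ S) →
        ‖∑ k ∈ Finset.range n, θ k • x k‖ ≤ c * ‖∑ k ∈ Finset.range n, x k‖)
    {N : ℕ} (hN : 2 ≤ N) (m r : ℕ) (x : X) (θ : ℕ → 𝕜) (hθ : ∀ k, θ k ∈ S) :
    ‖∑ k ∈ Finset.range m, θ (k + 1) • (R ((k + 1) * N + r + 1) x - R (k * N + r + 1) x) +
      θ 0 • R (0 * N + r + 1) x‖ ≤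
      c * (‖R (m * N + r + 1) x‖ + ‖∑ k ∈ Finset.range m,
        (1 : 𝕜) • (R (k * N + r + 1 + 1) x - R (k * N + r + 1) x)‖) +
      ‖∑ k ∈ Finset.range m,
        θ (k + 1) • (R (k * N + r + 1 + 1) x - R (k * N + r + 1) x)‖ := by
  -- Each block after the first starts one step after the previous block ends; it is nonempty
  -- because N ≥ 2.
  let a : ℕ → ℕ := fun k => Nat.casesOn k 0 fun k => k * N + r + 1 + 1
  let b : ℕ → ℕ := fun k => k * N + r + 1
  have hab : ∀ k, a k < b k := by
    intro k
    cases k with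
    | zero => simp [a, b]
    | succ k =>
      change k * N + r + 1 + 1 < (k + 1) * N + r + 1
      rw [Nat.succ_mul]
      omega
  have hba : ∀ k, b k < a (k + 1) := fun k => Nat.lt_succ_self _
  have h := hR a b hab hba (fun k => (R (b k) - R (a k)) x) (fun k => ⟨x, rfl⟩) (m + 1) θ hθ
  have e1 : ∀ φ : ℕ → 𝕜, ∑ k ∈ Finset.range (m + 1), φ k • (R (b k) - R (a k)) x =
      (∑ k ∈ Finset.range m, φ (k + 1) • (R ((k + 1) * N + r + 1) x - R (k * N + r + 1) x) +
        φ 0 • R (0 * N + r + 1) x) -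
      ∑ k ∈ Finset.range m, φ (k + 1) • (R (k * N + r + 1 + 1) x - R (k * N + r + 1) x) := by
    intro φ
    have e0 : (R (b 0) - R (a 0)) x = R (0 * N + r + 1) x := by
      change (R (0 * N + r + 1) - R 0) x = _
      rw [h0, sub_zero]
    rw [Finset.sum_range_succ', e0, add_sub_right_comm, ← Finset.sum_sub_distrib]
    congr 1
    refine Finset.sum_congr rfl fun k _ => ?_
    rw [← smul_sub, sub_sub_sub_cancel_right]
    rfl
  have e2 := e1 fun _ => 1
  rw [e1] at h
  simp only [one_smul] at e2
  rw [e2, Finset.sum_range_sub (fun k => R (k * N + r + 1) x), sub_add_cancel] at h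
  simp only [one_smul]
  set U := ∑ k ∈ Finset.range m, θ (k + 1) • (R ((k + 1) * N + r + 1) x - R (k * N + r + 1) x) +
      θ 0 • R (0 * N + r + 1) x
  set V := ∑ k ∈ Finset.range m, θ (k + 1) • (R (k * N + r + 1 + 1) x - R (k * N + r + 1) x)
  have e3 : U = (U - V) + V := by abel
  rw [e3]
  refine (norm_add_le _ _).trans (add_le_add (h.trans ?_) le_rfl)
  gcongr
  exact norm_sub_le _ _

/-- A signed sum for the block averages is the mean over residues r of signed sums along one residue
class. Skipped blocking contributes means of `‖R (m * N + r + 1) x‖`, which only tend to ‖x‖, hence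
the passage through `uncondBound_of_asymptotic`. -/
theorem hasUMAP_of_hasUncondSkippedBlocking {S : Set 𝕜} (hS : IsSignSet S)
    (hcot : HasFiniteCotype X) (h : HasUncondSkippedBlocking S X) : HasUMAP S X := by
  obtain ⟨q, hq, C, hC⟩ := hcot
  intro ε hε
  obtain ⟨R, ⟨hRa, K, hK⟩, hR⟩ := h (ε / 2) (by positivity)
  have hK0 : 0 ≤ K := (norm_nonneg _).trans (hK.norm_le hS hRa.zero 0)
  -- The omitted differences have mean norm at most ρ‖x‖ and enter twice: unsigned with factor 1 +
  -- ε/2 and signed with factor 1. The choice of N makes their total at most (ε/2)‖x‖.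
  obtain ⟨N, hNρ, hN⟩ : ∃ N : ℕ, (N : ℝ) ^ (-(1 / q)) * (|C| * (2 * K)) ≤
      ε / 2 / (1 + ε / 2 + 1) ∧ 2 ≤ N := by
    have h1 : Tendsto (fun N : ℕ => (N : ℝ) ^ (-(1 / q)) * (|C| * (2 * K))) atTop (𝓝 0) := by
      simpa only [zero_mul, Function.comp_def] using ((tendsto_rpow_neg_atTop (by positivity : 0 < 1 / q)).comp
        tendsto_natCast_atTop_atTop).mul_const (|C| * (2 * K))
    exact ((h1.eventually_le_const (by positivity)).and (eventually_ge_atTop 2)).exists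
  have hN0 : (0 : ℝ) < N := by exact_mod_cast (by omega : 0 < N)
  set ρ := (N : ℝ) ^ (-(1 / q)) * (|C| * (2 * K)) with hρ
  have hy : ∀ (m : ℕ) (x : X) (φ : ℕ → 𝕜), (∀ k, φ k ∈ S) →
      (N : ℝ)⁻¹ * ∑ r ∈ Finset.range N, ‖∑ k ∈ Finset.range m,
        φ k • (R (k * N + r + 1 + 1) x - R (k * N + r + 1) x)‖ ≤ ρ * ‖x‖ := by
    intro m x φ hφ
    have := sum_norm_le_of_cotype hq hC (fun r : Fin N => ∑ k ∈ Finset.range m,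
        φ k • (R (k * N + r + 1 + 1) x - R (k * N + r + 1) x))
      (fun σ => norm_sum_sign_smul_residues_le hS hK hRa.zero N m x φ hφ σ)
    rw [Finset.sum_range, inv_mul_le_iff₀ hN0]
    refine this.trans_eq ?_
    rw [hρ, sub_eq_add_neg, Real.rpow_add hN0, Real.rpow_one]
    ring
  refine ⟨blockAverage R N, isApproxSeq_blockAverage hRa (by omega), ?_⟩
  refine uncondBound_of_asymptotic hS (by positivity) (fun x n => (1 + ε / 2) *
    ((N : ℝ)⁻¹ * ∑ r ∈ Finset.range N, ‖R ((n - 1) * N + r + 1) x‖) + ε / 2 * ‖x‖) ?_ ?_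
  · intro x
    have h1 : ∀ r ∈ Finset.range N,
        Tendsto (fun n : ℕ => ‖R ((n - 1) * N + r + 1) x‖) atTop (𝓝 ‖x‖) := by
      intro r _
      refine ((hRa.tendsto x).comp (tendsto_atTop_mono (fun n => ?_)
        (tendsto_sub_atTop_nat 1))).norm
      have := Nat.le_mul_of_pos_right (n - 1) (by omega : 0 < N)
      omega
    have h2 := (((tendsto_finsetSum _ h1).const_mul (N : ℝ)⁻¹).const_mul (1 + ε / 2)).add_const
      (ε / 2 * ‖x‖)
    have e : (1 + ε / 2) * ((N : ℝ)⁻¹ * ∑ r ∈ Finset.range N, ‖x‖) + ε / 2 * ‖x‖ =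
        (1 + ε) * ‖x‖ := by
      rw [Finset.sum_const, Finset.card_range, nsmul_eq_mul, inv_mul_cancel_left₀ hN0.ne']
      ring
    rwa [e] at h2
  · intro x n θ hθ
    cases n with
    | zero =>
      rw [Finset.sum_range_zero, norm_zero]
      positivity
    | succ m =>
      have e : ∑ k ∈ Finset.range (m + 1), θ k • (blockAverage R N (k + 1) x - blockAverage R N k x)
          = (N : 𝕜)⁻¹ • ∑ r ∈ Finset.range N, (∑ k ∈ Finset.range m,
            θ (k + 1) • (R ((k + 1) * N + r + 1) x - R (k * N + r + 1) x) +
              θ 0 • R (0 * N + r + 1) x) := by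
        rw [Finset.sum_range_succ', Finset.sum_add_distrib, Finset.sum_comm, smul_add,
          Finset.smul_sum]
        congr 1
        · refine Finset.sum_congr rfl fun k _ => ?_
          rw [blockAverage_succ_apply, blockAverage_succ_apply, ← average_sub, average,
            ← Finset.smul_sum, smul_comm]
        · rw [blockAverage_succ_apply, average, ← Finset.smul_sum, smul_comm]
          simp [blockAverage]
      rw [e, norm_smul, norm_inv, RCLike.norm_natCast]
      have h1 := fun r => norm_sum_residue_le (by positivity : 0 ≤ 1 + ε / 2) hRa.zero hR hN
        m r x θ hθ
      have h2 := hy m x (fun _ => 1) fun _ => hS.one_mem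
      have h3 := hy m x (fun k => θ (k + 1)) fun k => hθ _
      have h4 := mul_le_mul_of_nonneg_left (norm_sum_le_of_le (Finset.range N) fun r _ => h1 r)
        (inv_nonneg.2 hN0.le)
      refine h4.trans ?_
      rw [Finset.sum_add_distrib, ← Finset.mul_sum, Finset.sum_add_distrib]
      have h5 : (1 + ε / 2 + 1) * (ρ * ‖x‖) ≤ ε / 2 * ‖x‖ := by
        rw [← mul_assoc]
        gcongr
        rw [mul_comm]
        exact (le_div_iff₀ (by positivity)).1 hNρ
      have h6 := mul_le_mul_of_nonneg_left h2 (by positivity : 0 ≤ 1 + ε / 2)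
      simp only [Nat.add_sub_cancel]
      linarith

end Cotype

/-- `S` is the set of real signs `{1, -1}` or the set of all scalars of modulus one. -/
theorem theorem5p3 {𝕜 : Type*} [RCLike 𝕜] {X : Type*} [NormedAddCommGroup X] [NormedSpace 𝕜 X]
    [CompleteSpace X] [TopologicalSpace.SeparableSpace X]
    (S : Set 𝕜) (hS : S = {1, -1} ∨ S = Metric.sphere (0 : 𝕜) 1) :
    -- metric unconditional approximation implies tau-unconditionality
    (HasUMAP S X →
      ∃ T : ℕ → X →L[𝕜] X, IsUncondApproxSeq S T ∧ IsCommutingSeq T ∧ ∃ τ : TopologicalSpace X,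
        IsVectorTopology 𝕜 τ ∧ TauUncond S τ ∧ TendstoIdUniformlyOnBall T τ) ∧
    -- tau-unconditionality is equivalent to block unconditionality
    ((∃ T : ℕ → X →L[𝕜] X, IsUncondApproxSeq S T ∧ IsCommutingSeq T ∧ ∃ τ : TopologicalSpace X,
        IsVectorTopology 𝕜 τ ∧ TauUncond S τ ∧ TendstoIdUniformlyOnBall T τ) ↔
      ∃ T : ℕ → X →L[𝕜] X, IsUncondApproxSeq S T ∧ IsCommutingSeq T ∧ BlockUncond S T) ∧
    -- block unconditionality implies skipped blocking decompositions
    ((∃ T : ℕ → X →L[𝕜] X, IsUncondApproxSeq S T ∧ IsCommutingSeq T ∧ BlockUncond S T) →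
      HasUncondSkippedBlocking S X) ∧
    -- the converse direction under finite cotype
    (HasFiniteCotype X → HasUncondSkippedBlocking S X → HasUMAP S X) := by
  have hS := isSignSet_of_eq hS
  have block_to_tau : (∃ T : ℕ → X →L[𝕜] X, IsUncondApproxSeq S T ∧ IsCommutingSeq T ∧
      BlockUncond S T) → ∃ T : ℕ → X →L[𝕜] X, IsUncondApproxSeq S T ∧ IsCommutingSeq T ∧
        ∃ τ : TopologicalSpace X, IsVectorTopology 𝕜 τ ∧ TauUncond S τ ∧
          TendstoIdUniformlyOnBall T τ := by
    rintro ⟨T, hT, hc, hB⟩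
    exact ⟨T, hT, hc, blockTopology T, isVectorTopology_blockTopology T,
      tauUncond_blockTopology hS hT.1 hB, tendstoIdUniformlyOnBall_blockTopology hT.1 hc⟩
  refine ⟨fun h => block_to_tau (h.exists_blockUncond hS), ⟨?_, block_to_tau⟩, fun h => ?_,
    hasUMAP_of_hasUncondSkippedBlocking hS⟩
  · rintro ⟨T, hT, hc, τ, hv, hτ, ht⟩
    obtain ⟨C, hC⟩ := hT.2
    exact ⟨T, hT, hc, blockUncond_of_tauUncond hS hT.1 (hC.norm_le hS hT.1.zero) hv hτ ht⟩
  -- The detour through τ is useful: block unconditionality speaks only of the sets `T n B`, whereas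
  -- the construction needs ranges of perturbed operators and all large m.
  · obtain ⟨T, hT, hc, τ, hv, hτ, ht⟩ := block_to_tau h
    exact hasUncondSkippedBlocking_of_tauUncond hS hT hc hv hτ ht
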